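/- Let $T$ be an infinite rooted ordered tree: a set of finite words on $\{1,2,\dots\}$ that contains the empty word $\varnothing$ (the root), is closed under deleting the last letter (taking the parent), and in which each $x\in T$ has a finite number $k_x$ of children, namely $x1,\dots,xk_x$. Let $\lambda>1$ and let $(Y_n)_{n\in\mathbb N}$ be the $\lambda$-biased random walk on $T$ with $Y_0=\varnothing$ a.s.: the Markov chain that, from $x\ne\varnothing$, jumps to the parent of $x$ with probability $\lambda/(\lambda+k_x)$ and to each child of $x$ with probability $1/(\lambda+k_x)$, and, from $\varnothing$, jumps to each child with probability $1/k_\varnothing$. Assume that $Y$ is recurrent. Turn $T$ into a real tree, with distance $d_{\mathrm{gr}}$, by replacing each edge by a segment of length $1$, and extend $Y$ to $(Y_s)_{s\ge 0}$ by letting it run at unit speed from $Y_n$ to $Y_{n+1}$ during $[n,n+1]$. Let $\zeta\in(0,\infty)$, and for $n\in\mathbb N$ let $\mathcal R_n=\{Y_s: 0\le s\le \zeta n\}$, with the occupation measure $m^{(n)}_{\mathrm{occ}}$, the image of Lebesgue measure on $[0,\zeta]$ by $s\mapsto Y_{ns}$. Let $(a_n)_{n\in\mathbb N}$ be positive real numbers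 with $\lim_{n\to\infty} a_n^{-1}\log n=0$, and suppose that there is a continuous random process $H=(H_s)_{s\in[0,\zeta]}$ such that $$\Big(\tfrac1{a_n}d_{\mathrm{gr}}(\varnothing,Y_{ns})\Big)_{s\in[0,\zeta]}\longrightarrow (H_s)_{s\in[0,\zeta]}\qquad (n\to\infty)$$ in law on $C([0,\zeta],\mathbb R)$ with the uniform norm. Then, jointly with this convergence (that is, as a convergence in law of pairs on $C([0,\zeta],\mathbb R)\times\mathbb M$ with the product topology), $$\Big(\mathcal R_n,\tfrac1{a_n}d_{\mathrm{gr}},\varnothing,m^{(n)}_{\mathrm{occ}}\Big)\longrightarrow (T_H,d_H,r_H,\mu_H)\qquad (n\to\infty)$$ in law on the space $\mathbb M$ of isometry classes of pointed compact metric spaces with a finite Borel measure, with the Gromov–Hausdorff–Prokhorov distance $$\delta_{\mathrm{GHP}}(E_1,E_2)=\inf\big\{d_E^{\mathrm{Haus}}(\phi_1(E_1),\phi_2(E_2))+d_E(\phi_1(r_1),\phi_2(r_2))+d_E^{\mathrm{Prok}}(\mu_1\circ\phi_1^{-1},\mu_2\circ\phi_2^{-1})\big\},$$ where $r_i$ and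 $\mu_i$ are the distinguished point and the measure of $E_i$, and the infimum is over all complete separable metric spaces $(E,d_E)$ and all isometric embeddings $\phi_i:E_i\to E$. Here $(T_H,d_H,r_H,\mu_H)$ is the real tree coded by $H$: with $d_H(s,s')=H_s+H_{s'}-2\min_{[s\wedge s',s\vee s']}H$, $T_H$ is the quotient of $[0,\zeta]$ by the relation $d_H(s,s')=0$, with the metric induced by $d_H$, $r_H$ is the class of $0$, and $\mu_H$ is the image of Lebesgue measure on $[0,\zeta]$ by the canonical projection. -/

import Mathlib

open MeasureTheory Filter Set
open scoped Topology ENNReal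

noncomputable section

namespace TreeWalk

/-! ### Rooted ordered trees -/

/-- Rooted ordered (locally finite) trees, as sets of finite words on the positive integers. -/
structure OrderedTree where
  carrier : Set (List ℕ)
  root_mem : [] ∈ carrier
  parent_mem : ∀ u ∈ carrier, u ≠ [] → u.dropLast ∈ carrier
  children : ∀ u ∈ carrier, ∃ k : ℕ, ∀ i : ℕ, u ++ [i] ∈ carrier ↔ 1 ≤ i ∧ i ≤ k

/-- The vertices of the tree. -/
abbrev Vertex (t : OrderedTree) : Type := {u : List ℕ // u ∈ t.carrier}

/-- The root: the empty word. -/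
def rootVertex (t : OrderedTree) : Vertex t := ⟨[], t.root_mem⟩

/-- `x` is the parent of `y`. -/
def IsParent {t : OrderedTree} (x y : Vertex t) : Prop := y.1 ≠ [] ∧ y.1.dropLast = x.1

/-- The number of children of a vertex. -/
def numChildren {t : OrderedTree} (x : Vertex t) : ℕ := {y : Vertex t | IsParent x y}.ncard

/-- The most recent common ancestor of two words: their longest common prefix. -/
def meet : List ℕ → List ℕ → List ℕ
  | a :: u, b :: v => if a = b then a :: meet u v else []
  | _, _ => []

theorem le_length_meet (k : ℕ) (u v : List ℕ) :
    k ≤ (meet u v).length ↔ k ≤ u.length ∧ k ≤ v.length ∧ u.take k = v.take k := by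
  induction u generalizing k v with
  | nil => cases v <;> simp +contextual [meet]
  | cons a u ih =>
    cases v with
    | nil => simp +contextual [meet]
    | cons b v =>
      cases k with
      | zero => simp
      | succ k =>
        by_cases h : a = b
        · simp [meet, h, ih]
        · simp [meet, h]

theorem length_meet_le_left (u v : List ℕ) : (meet u v).length ≤ u.length :=
  ((le_length_meet _ u v).1 le_rfl).1

theorem length_meet_le_right (u v : List ℕ) : (meet u v).length ≤ v.length :=
  ((le_length_meet _ u v).1 le_rfl).2.1

theorem length_meet_comm (u v : List ℕ) : (meet u v).length = (meet v u).length := by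
  refine le_antisymm ?_ ?_ <;>
  · rw [le_length_meet]
    have := (le_length_meet _ _ _).1 (le_refl (meet u v).length)
    have := (le_length_meet _ _ _).1 (le_refl (meet v u).length)
    grind

theorem length_meet_self (u : List ℕ) : (meet u u).length = u.length :=
  le_antisymm (length_meet_le_left u u) ((le_length_meet _ _ _).2 ⟨le_rfl, le_rfl, rfl⟩)

theorem min_length_meet_le (u v w : List ℕ) :
    min (meet u v).length (meet v w).length ≤ (meet u w).length := by
  obtain ⟨h1, -, h3⟩ := (le_length_meet _ _ _).1
    (min_le_left (meet u v).length (meet v w).length)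
  obtain ⟨-, h5, h6⟩ := (le_length_meet _ _ _).1
    (min_le_right (meet u v).length (meet v w).length)
  exact (le_length_meet _ _ _).2 ⟨h1, h5, h3.trans h6⟩

theorem length_meet_take (u v : List ℕ) (i j : ℕ) :
    (meet (u.take i) (v.take j)).length = min (min i j) (meet u v).length := by
  refine eq_of_forall_le_iff fun k => ?_
  rw [le_length_meet, le_min_iff, le_min_iff, le_length_meet]
  simp only [List.length_take, le_min_iff, List.take_take]
  constructor
  · rintro ⟨⟨h1, h2⟩, ⟨h3, h4⟩, h5⟩
    rw [min_eq_left h1, min_eq_left h3] at h5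
    exact ⟨⟨h1, h3⟩, h2, h4, h5⟩
  · rintro ⟨⟨h1, h3⟩, h2, h4, h5⟩
    rw [min_eq_left h1, min_eq_left h3]
    exact ⟨⟨h1, h2⟩, ⟨h3, h4⟩, h5⟩

theorem take_mem (t : OrderedTree) {u : List ℕ} (hu : u ∈ t.carrier) (i : ℕ) :
    u.take i ∈ t.carrier := by
  induction u using List.reverseRecOn with
  | nil => simpa using hu
  | append_singleton u a ih =>
    by_cases h : u.length < i
    · rwa [List.take_of_length_le (by simp; omega)]
    · rw [List.take_append_of_le_length (by omega)]
      exact ih (by simpa using t.parent_mem _ hu (by simp))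

/-! ### The biased random walk -/

/-- Transition probabilities of the biased walk with bias `lam`. -/
def transProb {t : OrderedTree} (lam : ℝ) (x y : Vertex t) : ℝ :=
  open scoped Classical in
  if IsParent y x then lam / (lam + numChildren x)
  else if IsParent x y then
    if x = rootVertex t then 1 / (numChildren x : ℝ) else 1 / (lam + numChildren x)
  else 0

/-- `Y` is a `lam`-biased random walk on `t`, under `P`, that starts at the root. -/
structure IsBiasedWalk {Ω : Type*} [MeasurableSpace Ω] (P : Measure Ω) (t : OrderedTree)
    (lam : ℝ) (Y : ℕ → Ω → Vertex t) : Prop where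
  measurable : ∀ (n : ℕ) (x : Vertex t), MeasurableSet {ω | Y n ω = x}
  start : ∀ᵐ ω ∂P, Y 0 ω = rootVertex t
  markov : ∀ (n : ℕ) (x : ℕ → Vertex t),
    P {ω | ∀ k ≤ n + 1, Y k ω = x k} =
      P {ω | ∀ k ≤ n, Y k ω = x k} * ENNReal.ofReal (transProb lam (x n) (x (n + 1)))

/-- Recurrence (the chain is irreducible, so it is enough to look at the root). -/
def IsRecurrent {Ω : Type*} [MeasurableSpace Ω] (P : Measure Ω) {t : OrderedTree}
    (Y : ℕ → Ω → Vertex t) : Prop :=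
  ∀ᵐ ω ∂P, ∃ᶠ n in atTop, Y n ω = rootVertex t

/-! ### The real tree spanned by a rooted ordered tree -/

/-- Points of the real tree obtained by replacing every edge by a unit segment. The pair `(v, s)`
with `v` not the root and `0 < s ≤ 1` is the point of the edge between `v` and its parent
that lies at distance `s` from the parent; `(v, 1)` is the vertex `v` itself. -/
@[ext] structure TreePoint (t : OrderedTree) where
  word : List ℕ
  frac : ℝ
  word_mem : word ∈ t.carrier
  frac_pos : 0 < frac
  frac_le : frac ≤ 1
  frac_root : word = [] → frac = 1

namespace TreePoint

variable {t : OrderedTree}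

/-- Distance to the root. -/
def height (p : TreePoint t) : ℝ := p.word.length - 1 + p.frac

/-- Height of the most recent common ancestor (in the real tree) of two points. -/
def meetHeight (p q : TreePoint t) : ℝ :=
  min (min p.height q.height) ((meet p.word q.word).length : ℝ)

theorem meetHeight_comm (p q : TreePoint t) : p.meetHeight q = q.meetHeight p := by
  rw [meetHeight, meetHeight, length_meet_comm, min_comm p.height]

theorem meetHeight_self (p : TreePoint t) : p.meetHeight p = p.height := by
  have := p.frac_le
  rw [meetHeight, length_meet_self, min_self, min_eq_left]
  rw [height]; linarith

/-- The tree distance `h(p) + h(q) - 2 h(p ∧ q)`. -/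
instance : MetricSpace (TreePoint t) where
  dist p q := p.height + q.height - 2 * p.meetHeight q
  dist_self p := by rw [meetHeight_self]; ring
  dist_comm p q := by rw [meetHeight_comm]; ring
  dist_triangle p q r := by
    have h : (min (meet p.word q.word).length (meet q.word r.word).length : ℝ)
        ≤ (meet p.word r.word).length := by
      exact_mod_cast min_length_meet_le p.word q.word r.word
    have h1 : p.meetHeight q ≤ p.height := (min_le_left _ _).trans (min_le_left _ _)
    have h2 : p.meetHeight q ≤ q.height := (min_le_left _ _).trans (min_le_right _ _)
    have h3 : p.meetHeight q ≤ (meet p.word q.word).length := min_le_right _ _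
    have h4 : q.meetHeight r ≤ q.height := (min_le_left _ _).trans (min_le_left _ _)
    have h5 : q.meetHeight r ≤ r.height := (min_le_left _ _).trans (min_le_right _ _)
    have h6 : q.meetHeight r ≤ (meet q.word r.word).length := min_le_right _ _
    have h7 : min (p.meetHeight q) (q.meetHeight r) ≤ p.meetHeight r :=
      le_min (le_min ((min_le_left _ _).trans h1) ((min_le_right _ _).trans h5))
        ((min_le_min h3 h6).trans h)
    have h8 : p.meetHeight q + q.meetHeight r
        = min (p.meetHeight q) (q.meetHeight r) + max (p.meetHeight q) (q.meetHeight r) :=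
      (min_add_max _ _).symm
    have h9 : max (p.meetHeight q) (q.meetHeight r) ≤ q.height := max_le h2 h4
    linarith
  eq_of_dist_eq_zero {p q} h := by
    have h1 : p.meetHeight q ≤ p.height := (min_le_left _ _).trans (min_le_left _ _)
    have h2 : p.meetHeight q ≤ q.height := (min_le_left _ _).trans (min_le_right _ _)
    have h3 : p.meetHeight q ≤ (meet p.word q.word).length := min_le_right _ _
    have h0 : p.height + q.height - 2 * p.meetHeight q = 0 := h
    have hp : p.height = p.meetHeight q := by linarith
    have hq : q.height = p.meetHeight q := by linarith
    have hpf := p.frac_pos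
    have hqf := q.frac_pos
    have e1 : p.word.length ≤ (meet p.word q.word).length := by
      have : (p.word.length : ℝ) < (meet p.word q.word).length + 1 := by
        rw [height] at hp; linarith
      exact Nat.lt_succ_iff.1 (by exact_mod_cast this)
    have e2 : q.word.length ≤ (meet p.word q.word).length := by
      have : (q.word.length : ℝ) < (meet p.word q.word).length + 1 := by
        rw [height] at hq; linarith
      exact Nat.lt_succ_iff.1 (by exact_mod_cast this)
    have e3 := (le_length_meet _ _ _).1 (le_refl (meet p.word q.word).length)
    have e4 : p.word = q.word := by
      have := e3.2.2
      rwa [List.take_of_length_le e1, List.take_of_length_le e2] at this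
    refine TreePoint.ext e4 ?_
    have : p.height = q.height := hp.trans hq.symm
    rw [height, height, e4] at this
    linarith

theorem dist_def (p q : TreePoint t) : dist p q = p.height + q.height - 2 * p.meetHeight q := rfl

/-- A vertex, seen as a point of the spanned real tree. -/
def ofVertex (v : Vertex t) : TreePoint t := ⟨v.1, 1, v.2, one_pos, le_rfl, fun _ => rfl⟩

/-- The point at height `h` on the geodesic from the root to `v` (`h` is clamped to `[0, |v|]`). -/
def onLine (v : Vertex t) (h : ℝ) : TreePoint t where
  word := v.1.take ⌈max 0 (min h v.1.length)⌉₊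
  frac := max 0 (min h v.1.length) - ⌈max 0 (min h v.1.length)⌉₊ + 1
  word_mem := take_mem t v.2 _
  frac_pos := by
    have := Nat.ceil_lt_add_one (le_max_left 0 (min h (v.1.length : ℝ)))
    linarith
  frac_le := by
    have := Nat.le_ceil (max 0 (min h (v.1.length : ℝ)))
    linarith
  frac_root := by
    intro h0
    rcases List.take_eq_nil_iff.1 h0 with h0 | h0
    · have := Nat.ceil_eq_zero.1 h0
      have h1 := le_antisymm this (le_max_left 0 (min h (v.1.length : ℝ)))
      rw [h1]; simp
    · have : max 0 (min h (v.1.length : ℝ)) = 0 := by rw [h0]; simp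
      rw [this]; simp

theorem ceil_le_length (v : Vertex t) {h : ℝ} (h1 : h ≤ v.1.length) : ⌈h⌉₊ ≤ v.1.length :=
  Nat.ceil_le.2 h1

theorem height_onLine (v : Vertex t) {h : ℝ} (h0 : 0 ≤ h) (h1 : h ≤ v.1.length) :
    (onLine v h).height = h := by
  simp only [height, onLine, min_eq_left h1, max_eq_right h0, List.length_take,
    min_eq_left (ceil_le_length v h1)]
  ring

theorem dist_onLine (v w : Vertex t) {h k : ℝ} (h0 : 0 ≤ h) (h1 : h ≤ v.1.length)
    (k0 : 0 ≤ k) (k1 : k ≤ w.1.length) :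
    dist (onLine v h) (onLine w k) = h + k - 2 * min (min h k) (meet v.1 w.1).length := by
  rw [dist_def, meetHeight, height_onLine v h0 h1, height_onLine w k0 k1]
  congr 2
  simp only [onLine, min_eq_left h1, max_eq_right h0, min_eq_left k1, max_eq_right k0]
  rw [length_meet_take]
  push_cast
  have a1 := Nat.le_ceil h
  have a2 := Nat.le_ceil k
  rw [← min_assoc]
  congr 1
  exact min_eq_left (min_le_min a1 a2)

/-- Graph distance between two vertices. -/
def vdist (x y : Vertex t) : ℝ := x.1.length + y.1.length - 2 * (meet x.1 y.1).length

/-- The point at distance `r` from `x` on the geodesic from `x` to `y`, for `0 ≤ r ≤ vdist x y`. -/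
def geodesic (x y : Vertex t) (r : ℝ) : TreePoint t :=
  if r ≤ x.1.length - (meet x.1 y.1).length then onLine x (x.1.length - r)
  else onLine y (r - x.1.length + 2 * (meet x.1 y.1).length)

theorem dist_geodesic (x y : Vertex t) {r r' : ℝ} (h0 : 0 ≤ r) (h : r ≤ r')
    (h1 : r' ≤ vdist x y) : dist (geodesic x y r) (geodesic x y r') = r' - r := by
  have hx : ((meet x.1 y.1).length : ℝ) ≤ x.1.length := by
    exact_mod_cast length_meet_le_left x.1 y.1
  have hc : (0 : ℝ) ≤ (meet x.1 y.1).length := by positivity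
  unfold geodesic
  unfold vdist at h1
  split_ifs with c1 c2 c2
  · rw [dist_onLine _ _ (by linarith) (by linarith) (by linarith) (by linarith),
      length_meet_self, min_eq_right (by linarith : (x.1.length : ℝ) - r' ≤ x.1.length - r),
      min_eq_left (by linarith)]
    ring
  · rw [dist_onLine _ _ (by linarith) (by linarith) (by linarith) (by linarith),
      min_eq_right (le_min (by linarith) (by linarith))]
    ring
  · linarith
  · rw [dist_onLine _ _ (by linarith) (by linarith) (by linarith) (by linarith),
      length_meet_self, min_eq_left (by linarith :
        r - x.1.length + 2 * (meet x.1 y.1).length ≤ r' - x.1.length + 2 * (meet x.1 y.1).length),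
      min_eq_left (by linarith)]
    ring

theorem onLine_length (x : Vertex t) : onLine x x.1.length = ofVertex x := by
  ext1 <;> simp [onLine, ofVertex]

theorem geodesic_zero (x y : Vertex t) : geodesic x y 0 = ofVertex x := by
  have hx : ((meet x.1 y.1).length : ℝ) ≤ x.1.length := by
    exact_mod_cast length_meet_le_left x.1 y.1
  rw [geodesic, if_pos (by linarith), sub_zero, onLine_length]

theorem vdist_nonneg (x y : Vertex t) : 0 ≤ vdist x y := by
  have hx : ((meet x.1 y.1).length : ℝ) ≤ x.1.length := by
    exact_mod_cast length_meet_le_left x.1 y.1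
  have hy : ((meet x.1 y.1).length : ℝ) ≤ y.1.length := by
    exact_mod_cast length_meet_le_right x.1 y.1
  unfold vdist; linarith

theorem geodesic_vdist (x y : Vertex t) : geodesic x y (vdist x y) = ofVertex y := by
  have hx : ((meet x.1 y.1).length : ℝ) ≤ x.1.length := by
    exact_mod_cast length_meet_le_left x.1 y.1
  have hy : ((meet x.1 y.1).length : ℝ) ≤ y.1.length := by
    exact_mod_cast length_meet_le_right x.1 y.1
  unfold geodesic vdist
  split_ifs with h
  · have e : y.1.length = (meet x.1 y.1).length := by
      have : (y.1.length : ℝ) = (meet x.1 y.1).length := by linarith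
      exact_mod_cast this
    have e' : meet x.1 y.1 = y.1 ∧ y.1 = x.1.take y.1.length := by
      have h3 := (le_length_meet _ _ _).1 (le_refl (meet x.1 y.1).length)
      rw [← e] at h3
      have h4 : y.1 = x.1.take y.1.length := by
        rw [h3.2.2, List.take_length]
      refine ⟨?_, h4⟩
      clear h3 h hx hy
      generalize x.1 = u at *
      generalize y.1 = v at *
      clear e
      induction v generalizing u with
      | nil => cases u <;> simp [meet]
      | cons b v ih =>
        cases u with
        | nil => simp at h4
        | cons a u =>
          simp only [List.length_cons, List.take_succ_cons, List.cons.injEq] at h4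
          simp [meet, h4.1.symm, ih u h4.2]
    have e2 : (x.1.length : ℝ) - (x.1.length + y.1.length - 2 * (meet x.1 y.1).length)
        = y.1.length := by rw [← e]; ring
    have hyx : (y.1.length : ℝ) ≤ x.1.length := by rw [e]; exact hx
    rw [e2]
    have h5 : ⌈max (0 : ℝ) (min (y.1.length : ℝ) x.1.length)⌉₊ = y.1.length := by
      rw [min_eq_left hyx, max_eq_right (by positivity), Nat.ceil_natCast]
    refine TreePoint.ext ?_ ?_
    · simp only [onLine, h5, ofVertex]; exact e'.2.symm
    · simp only [onLine, h5, ofVertex]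
      rw [min_eq_left hyx, max_eq_right (by positivity)]; ring
  · rw [← onLine_length]; congr 1; ring

end TreePoint

open TreePoint

/-- Continuous interpolation of a sequence of vertices: on `[n, n + 1]` it runs at constant speed
along the geodesic from `y n` to `y (n + 1)`. If `y n` and `y (n + 1)` are neighbours (almost surely
the case for the walk), the speed is one. -/
def interp {t : OrderedTree} (y : ℕ → Vertex t) (s : ℝ) : TreePoint t :=
  geodesic (y ⌊s⌋₊) (y (⌊s⌋₊ + 1)) ((s - ⌊s⌋₊) * vdist (y ⌊s⌋₊) (y (⌊s⌋₊ + 1)))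

theorem interp_eq {t : OrderedTree} (y : ℕ → Vertex t) (n : ℕ) {s : ℝ} (h : s ∈ Icc (n : ℝ) (n + 1)) :
    interp y s = geodesic (y n) (y (n + 1)) ((s - n) * vdist (y n) (y (n + 1))) := by
  rcases h.2.eq_or_lt with h2 | h2
  · have : ⌊s⌋₊ = n + 1 := by
      rw [h2]; exact_mod_cast Nat.floor_natCast (n + 1)
    rw [interp, this, h2]
    push_cast
    rw [sub_self, zero_mul, geodesic_zero, add_sub_cancel_left, one_mul, geodesic_vdist]
  · have : ⌊s⌋₊ = n := (Nat.floor_eq_iff ((Nat.cast_nonneg n).trans h.1)).2 ⟨h.1, h2⟩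
    rw [interp, this]

theorem continuousOn_interp {t : OrderedTree} (y : ℕ → Vertex t) :
    ContinuousOn (interp y) (Ici 0) := by
  have step (n : ℕ) : ContinuousOn (interp y) (Icc (n : ℝ) (n + 1)) := by
    have key : ∀ s ∈ Icc (n : ℝ) (n + 1), ∀ s' ∈ Icc (n : ℝ) (n + 1), s ≤ s' →
        dist (interp y s) (interp y s') = vdist (y n) (y (n + 1)) * (s' - s) := by
      intro s hs s' hs' hss
      have hd := vdist_nonneg (y n) (y (n + 1))
      rw [interp_eq y n hs, interp_eq y n hs', dist_geodesic]
      · ring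
      · exact mul_nonneg (by linarith [hs.1]) hd
      · exact mul_le_mul_of_nonneg_right (by linarith) hd
      · exact mul_le_of_le_one_left hd (by linarith [hs'.2])
    refine LipschitzOnWith.continuousOn (K := ⟨_, vdist_nonneg (y n) (y (n + 1))⟩)
      (LipschitzOnWith.of_dist_le_mul fun s hs s' hs' => ?_)
    rcases le_total s s' with h | h
    · rw [key s hs s' hs' h, Real.dist_eq, abs_sub_comm, abs_of_nonneg (by linarith)]; rfl
    · rw [dist_comm, key s' hs' s hs h, Real.dist_eq, abs_of_nonneg (by linarith)]; rfl
  have all (N : ℕ) : ContinuousOn (interp y) (Icc 0 (N : ℝ)) := by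
    induction N with
    | zero => rw [Nat.cast_zero, Icc_self]; exact continuousOn_singleton _ _
    | succ N ih =>
      have : Icc (0 : ℝ) ((N + 1 : ℕ) : ℝ) = Icc 0 (N : ℝ) ∪ Icc (N : ℝ) (N + 1) := by
        rw [Icc_union_Icc_eq_Icc (by positivity) (by linarith)]; push_cast; rfl
      rw [this]
      exact ih.union_of_isClosed (step N) isClosed_Icc isClosed_Icc
  intro s hs
  obtain ⟨N, hN⟩ := exists_nat_gt s
  refine (all N s ⟨hs, hN.le⟩).mono_of_mem_nhdsWithin ?_
  have : Iio (N : ℝ) ∈ 𝓝 s := Iio_mem_nhds hN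
  filter_upwards [self_mem_nhdsWithin, mem_nhdsWithin_of_mem_nhds this] with r h1 h2
  exact ⟨h1, le_of_lt h2⟩

theorem continuous_interp_comp {t : OrderedTree} (y : ℕ → Vertex t) (ζ : ℝ) (n : ℕ) :
    Continuous fun s : Icc (0 : ℝ) ζ => interp y (n * s) :=
  (continuousOn_interp y).comp_continuous (by fun_prop)
    fun s => mul_nonneg (Nat.cast_nonneg n) s.2.1

/-- The rescaled distance to the root, `s ↦ d(∅, Y_{ns}) / a`, as an element of `C([0, ζ], ℝ)`. -/
def rescaledHeight {t : OrderedTree} (y : ℕ → Vertex t) (ζ : ℝ) (n : ℕ) (a : ℝ) :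
    C(Icc (0 : ℝ) ζ, ℝ) where
  toFun s := (1 / a) * dist (ofVertex (rootVertex t)) (interp y (n * s))
  continuous_toFun :=
    continuous_const.mul (continuous_const.dist (continuous_interp_comp y ζ n))

/-! ### Pointed measured compact metric spaces and the Gromov-Hausdorff-Prokhorov topology -/

/-- Pointed compact metric spaces with a finite Borel measure. -/
structure PMSpace where
  carrier : Type
  [metric : MetricSpace carrier]
  [compact : CompactSpace carrier]
  [meas : MeasurableSpace carrier]
  [borel : BorelSpace carrier]
  root : carrier
  measure : Measure carrier
  [finite : IsFiniteMeasure measure]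

attribute [instance] PMSpace.metric PMSpace.compact PMSpace.meas PMSpace.borel PMSpace.finite

/-- Isometry of pointed measured metric spaces: a bijective isometry that preserves the
distinguished points and the measures. -/
instance PMSpace.setoid : Setoid PMSpace where
  r X Y := ∃ e : X.carrier ≃ᵢ Y.carrier, e X.root = Y.root ∧ X.measure.map e = Y.measure
  iseqv :=
    { refl := fun X => ⟨IsometryEquiv.refl _, rfl, Measure.map_id⟩
      symm := by
        rintro X Y ⟨e, h1, h2⟩
        refine ⟨e.symm, by rw [← h1]; simp, ?_⟩
        rw [← h2, Measure.map_map e.symm.continuous.measurable e.continuous.measurable]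
        have : (e.symm ∘ e : X.carrier → X.carrier) = id := funext fun x => e.symm_apply_apply x
        rw [this, Measure.map_id]
      trans := by
        rintro X Y Z ⟨e, h1, h2⟩ ⟨f, h3, h4⟩
        refine ⟨e.trans f, by simp [h1, h3], ?_⟩
        rw [← h4, ← h2, Measure.map_map f.continuous.measurable e.continuous.measurable]
        rfl }

/-- The Gromov-Hausdorff-Prokhorov distance: the infimum runs over all isometric embeddings of the
two spaces in a common complete separable metric space. -/
def ghpDist (X Y : PMSpace) : ℝ≥0∞ :=
  sInf {r : ℝ≥0∞ | ∃ (E : Type) (_ : MetricSpace E) (_ : CompleteSpace E)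
    (_ : TopologicalSpace.SeparableSpace E) (_ : MeasurableSpace E) (_ : BorelSpace E)
    (φ : X.carrier → E) (ψ : Y.carrier → E), Isometry φ ∧ Isometry ψ ∧
      r = Metric.hausdorffEDist (range φ) (range ψ) + edist (φ X.root) (ψ Y.root)
        + levyProkhorovEDist (X.measure.map φ) (Y.measure.map ψ)}

/-- Isometry classes of pointed measured compact metric spaces. -/
def GHPSpace : Type 1 := Quotient PMSpace.setoid

/-- The isometry class of a space. -/
def PMSpace.toGHP (X : PMSpace) : GHPSpace := Quotient.mk _ X

/-- The topology of the GHP distance: a set is open if it contains a ball around each of its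
points. -/
instance : TopologicalSpace GHPSpace where
  IsOpen U := ∀ X : PMSpace, X.toGHP ∈ U →
    ∃ ε : ℝ≥0∞, 0 < ε ∧ ∀ Y : PMSpace, ghpDist X Y < ε → Y.toGHP ∈ U
  isOpen_univ := fun _ _ => ⟨1, one_pos, fun _ _ => mem_univ _⟩
  isOpen_inter := by
    intro U V hU hV X hX
    obtain ⟨ε, h1, h2⟩ := hU X hX.1
    obtain ⟨δ, h3, h4⟩ := hV X hX.2
    exact ⟨min ε δ, lt_min h1 h3, fun Y hY =>
      ⟨h2 Y (hY.trans_le (min_le_left _ _)), h4 Y (hY.trans_le (min_le_right _ _))⟩⟩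
  isOpen_sUnion := by
    rintro S hS X ⟨U, hU, hX⟩
    obtain ⟨ε, h1, h2⟩ := hS U hU X hX
    exact ⟨ε, h1, fun Y hY => ⟨U, hU, h2 Y hY⟩⟩

/-! ### The range of the walk -/

/-- The set `α`, to be equipped with the metric `c · d`. -/
def Scaled (α : Type) (c : ℝ) (_ : 0 < c) : Type := α

/-- The identity map. -/
def toScaled {α : Type} {c : ℝ} (hc : 0 < c) (x : α) : Scaled α c hc := x

/-- The metric `c · d`. -/
instance (α : Type) [MetricSpace α] (c : ℝ) (hc : 0 < c) : MetricSpace (Scaled α c hc) where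
  dist x y := c * dist (α := α) x y
  dist_self x := by rw [dist_self (α := α) x, mul_zero]
  dist_comm x y := by rw [dist_comm (α := α) x y]
  dist_triangle x y z := by
    rw [← mul_add]; exact mul_le_mul_of_nonneg_left (dist_triangle (α := α) x y z) hc.le
  eq_of_dist_eq_zero {x y} h :=
    dist_eq_zero (γ := α).1 ((mul_eq_zero.1 h).resolve_left hc.ne')

theorem dist_toScaled {α : Type} [MetricSpace α] {c : ℝ} (hc : 0 < c) (x y : α) :
    dist (toScaled hc x) (toScaled hc y) = c * dist x y := rfl

theorem continuous_toScaled {α : Type} [MetricSpace α] {c : ℝ} (hc : 0 < c) :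
    Continuous (toScaled hc : α → Scaled α c hc) :=
  (LipschitzWith.of_dist_le_mul (K := ⟨c, hc.le⟩) fun _ _ => le_rfl).continuous

instance (α : Type) [MetricSpace α] [CompactSpace α] (c : ℝ) (hc : 0 < c) :
    CompactSpace (Scaled α c hc) :=
  ⟨by
    have h := isCompact_univ.image (continuous_toScaled (α := α) hc)
    have hs : Function.Surjective (toScaled hc : α → Scaled α c hc) := fun x => ⟨x, rfl⟩
    rwa [image_univ, hs.range_eq] at h⟩

instance (α : Type) [MetricSpace α] (c : ℝ) (hc : 0 < c) : MeasurableSpace (Scaled α c hc) :=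
  borel _

instance (α : Type) [MetricSpace α] (c : ℝ) (hc : 0 < c) : BorelSpace (Scaled α c hc) := ⟨rfl⟩

/-- The range `{Y_s ; s ∈ [0, ζ n]}` of the interpolated path. -/
def pathRange {t : OrderedTree} (y : ℕ → Vertex t) (ζ : ℝ) (n : ℕ) : Set (TreePoint t) :=
  interp y '' Icc 0 (ζ * n)

/-- The map `s ↦ Y_{ns}` from `[0, ζ]` to the range. -/
def toPathRange {t : OrderedTree} (y : ℕ → Vertex t) (ζ : ℝ) (n : ℕ) (s : Icc (0 : ℝ) ζ) :
    pathRange y ζ n :=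
  ⟨interp y (n * s), n * s, ⟨mul_nonneg (Nat.cast_nonneg n) s.2.1, by
    rw [mul_comm]; exact mul_le_mul_of_nonneg_right s.2.2 (Nat.cast_nonneg n)⟩, rfl⟩

theorem isCompact_pathRange {t : OrderedTree} (y : ℕ → Vertex t) (ζ : ℝ) (n : ℕ) :
    IsCompact (pathRange y ζ n) :=
  isCompact_Icc.image_of_continuousOn
    ((continuousOn_interp y).mono fun _ hs => hs.1)

instance {t : OrderedTree} (y : ℕ → Vertex t) (ζ : ℝ) (n : ℕ) : CompactSpace (pathRange y ζ n) :=
  isCompact_iff_compactSpace.1 (isCompact_pathRange y ζ n)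

/-- Lebesgue measure on `[0, ζ]`. -/
def lebesgue (ζ : ℝ) : Measure (Icc (0 : ℝ) ζ) := Measure.comap Subtype.val volume

instance (ζ : ℝ) : IsFiniteMeasure (lebesgue ζ) :=
  ⟨by
    rw [lebesgue, comap_subtype_coe_apply measurableSet_Icc, image_univ,
      Subtype.range_coe, Real.volume_Icc]
    exact ENNReal.ofReal_lt_top⟩

/-- The range of the path up to time `ζ n`, with the distance divided by `a`, pointed at the
initial position `Y_0` of the path (almost surely the root of the tree, for the walk), and with the
occupation measure, i.e. the image of Lebesgue measure on `[0, ζ]` by `s ↦ Y_{ns}`. -/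
def rangeSpace {t : OrderedTree} (y : ℕ → Vertex t) (ζ : ℝ) (hζ : 0 < ζ) (n : ℕ)
    (a : ℝ) (ha : 0 < a) : PMSpace :=
  { carrier := Scaled (pathRange y ζ n) (1 / a) (one_div_pos.2 ha)
    root := toScaled _ (toPathRange y ζ n ⟨0, le_rfl, hζ.le⟩)
    measure := (lebesgue ζ).map fun s => toScaled _ (toPathRange y ζ n s) }

/-! ### Spaces induced by pseudo-metrics on an interval, real trees coded by functions -/

/-- Continuous pseudo-metrics on `[0, ζ]`. -/
structure ContPseudoMetric (ζ : ℝ) where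
  d : Icc (0 : ℝ) ζ → Icc (0 : ℝ) ζ → ℝ
  self : ∀ s, d s s = 0
  symm : ∀ s s', d s s' = d s' s
  triangle : ∀ s s' s'', d s s'' ≤ d s s' + d s' s''
  continuous : Continuous fun p : Icc (0 : ℝ) ζ × Icc (0 : ℝ) ζ => d p.1 p.2

namespace ContPseudoMetric

variable {ζ : ℝ} (D : ContPseudoMetric ζ)

theorem nonneg (s s' : Icc (0 : ℝ) ζ) : 0 ≤ D.d s s' := by
  have h1 := D.triangle s s' s
  rw [D.self, D.symm s' s] at h1
  linarith

/-- Points at distance zero are identified. -/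
def setoid : Setoid (Icc (0 : ℝ) ζ) where
  r s s' := D.d s s' = 0
  iseqv :=
    { refl := D.self
      symm := fun {s s'} h => by rw [D.symm]; exact h
      trans := fun {s s' s''} h h' => le_antisymm
        (by have := D.triangle s s' s''; rw [h, h'] at this; linarith) (D.nonneg _ _) }

/-- The quotient `[0, ζ] / ∼`. -/
def Quot : Type := Quotient D.setoid

/-- The canonical projection. -/
def proj (s : Icc (0 : ℝ) ζ) : D.Quot := Quotient.mk D.setoid s

/-- The metric induced on the quotient. -/
instance : MetricSpace D.Quot where
  dist := Quotient.lift₂ D.d (by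
    intro s u s' u' (h : D.d s s' = 0) (h' : D.d u u' = 0)
    have h1 := D.triangle s s' u
    have h2 := D.triangle s' u' u
    have h3 := D.triangle s' s u'
    have h4 := D.triangle s u u'
    rw [D.symm u' u] at h2
    rw [D.symm s' s] at h3
    linarith)
  dist_self := by rintro ⟨s⟩; exact D.self s
  dist_comm := by rintro ⟨s⟩ ⟨u⟩; exact D.symm s u
  dist_triangle := by rintro ⟨s⟩ ⟨u⟩ ⟨v⟩; exact D.triangle s u v
  eq_of_dist_eq_zero := by rintro ⟨s⟩ ⟨u⟩ h; exact Quotient.sound h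

theorem dist_proj (s s' : Icc (0 : ℝ) ζ) : dist (D.proj s) (D.proj s') = D.d s s' := rfl

theorem continuous_proj : Continuous D.proj := by
  refine continuous_iff_continuousAt.2 fun s => tendsto_iff_dist_tendsto_zero.2 ?_
  have : Continuous fun u => D.d u s := D.continuous.comp (by fun_prop : Continuous fun u => (u, s))
  simpa only [dist_proj, D.self] using this.tendsto s

instance : CompactSpace D.Quot :=
  ⟨by
    have h := isCompact_univ.image D.continuous_proj
    have hs : Function.Surjective D.proj := fun q => Quotient.exists_rep q
    rwa [image_univ, hs.range_eq] at h⟩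

instance : MeasurableSpace D.Quot := borel _

instance : BorelSpace D.Quot := ⟨rfl⟩

/-- The pointed measured compact metric space induced by a pseudo-metric: the root is the class
of `0` and the measure is the image of Lebesgue measure. -/
def space (hζ : 0 < ζ) : PMSpace :=
  { carrier := D.Quot
    root := D.proj ⟨0, le_rfl, hζ.le⟩
    measure := (lebesgue ζ).map D.proj }

end ContPseudoMetric

/-- The minimum of `h` between `s` and `s'`. -/
def minBetween {ζ : ℝ} (h : C(Icc (0 : ℝ) ζ, ℝ)) (s s' : Icc (0 : ℝ) ζ) : ℝ :=
  sInf (h '' uIcc s s')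

theorem bddBelow_image {ζ : ℝ} (h : C(Icc (0 : ℝ) ζ, ℝ)) (A : Set (Icc (0 : ℝ) ζ)) :
    BddBelow (h '' A) :=
  ((isCompact_range h.continuous).bddBelow).mono (image_subset_range _ _)

theorem minBetween_le {ζ : ℝ} (h : C(Icc (0 : ℝ) ζ, ℝ)) {s s' u : Icc (0 : ℝ) ζ}
    (hu : u ∈ uIcc s s') : minBetween h s s' ≤ h u :=
  csInf_le (bddBelow_image h _) (mem_image_of_mem _ hu)

theorem le_minBetween {ζ : ℝ} (h : C(Icc (0 : ℝ) ζ, ℝ)) {s s' : Icc (0 : ℝ) ζ} {c : ℝ}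
    (hc : ∀ u ∈ uIcc s s', c ≤ h u) : c ≤ minBetween h s s' :=
  le_csInf ⟨_, mem_image_of_mem _ left_mem_uIcc⟩ (by rintro _ ⟨u, hu, rfl⟩; exact hc u hu)

/-- The tree pseudo-metric `h(s) + h(s') - 2 min h` coded by `h`. -/
def codedPseudoMetric {ζ : ℝ} (h : C(Icc (0 : ℝ) ζ, ℝ)) : ContPseudoMetric ζ where
  d s s' := h s + h s' - 2 * minBetween h s s'
  self s := by simp [minBetween]; ring
  symm s s' := by rw [minBetween, minBetween, uIcc_comm]; ring
  triangle s s' s'' := by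
    have h0 : min (minBetween h s s') (minBetween h s' s'') ≤ minBetween h s s'' := by
      refine le_minBetween h fun u hu => ?_
      rcases uIcc_subset_uIcc_union_uIcc (b := s') hu with hu | hu
      · exact (min_le_left _ _).trans (minBetween_le h hu)
      · exact (min_le_right _ _).trans (minBetween_le h hu)
    have h1 : max (minBetween h s s') (minBetween h s' s'') ≤ h s' :=
      max_le (minBetween_le h right_mem_uIcc) (minBetween_le h left_mem_uIcc)
    have h2 := min_add_max (minBetween h s s') (minBetween h s' s'')
    linarith
  continuous := by
    have hK : Continuous fun p : Icc (0 : ℝ) ζ × Icc (0 : ℝ) ζ =>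
        sInf ((fun u => h ((u ⊔ (p.1 ⊓ p.2)) ⊓ (p.1 ⊔ p.2))) '' univ) := by
      refine isCompact_univ.continuous_sInf
        (f := fun (p : Icc (0 : ℝ) ζ × Icc (0 : ℝ) ζ) u => h ((u ⊔ (p.1 ⊓ p.2)) ⊓ (p.1 ⊔ p.2))) ?_
      exact h.continuous.comp (by fun_prop)
    have hE : (fun p : Icc (0 : ℝ) ζ × Icc (0 : ℝ) ζ => minBetween h p.1 p.2) = fun p =>
        sInf ((fun u => h ((u ⊔ (p.1 ⊓ p.2)) ⊓ (p.1 ⊔ p.2))) '' univ) := by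
      funext p
      unfold minBetween
      congr 1
      ext c
      constructor
      · rintro ⟨u, hu, rfl⟩
        exact ⟨u, mem_univ _, by
          simp only; rw [sup_eq_left.2 hu.1, inf_eq_left.2 hu.2]⟩
      · rintro ⟨u, -, rfl⟩
        exact ⟨_, ⟨le_inf le_sup_right inf_le_sup, inf_le_right⟩, rfl⟩
    exact ((h.continuous.comp continuous_fst).add (h.continuous.comp continuous_snd)).sub
      (continuous_const.mul (hE ▸ hK))

/-- The real tree coded by `h`, with its distance, root and measure. -/
def codedTree {ζ : ℝ} (hζ : 0 < ζ) (h : C(Icc (0 : ℝ) ζ, ℝ)) : PMSpace :=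
  (codedPseudoMetric h).space hζ

/-! ### Convergence in law -/

/-- Convergence in law of random elements of a topological space with its Borel sigma-field. -/
def TendstoInLaw {E Ω Ω' : Type*} [TopologicalSpace E] [MeasurableSpace Ω] [MeasurableSpace Ω']
    (X : ℕ → Ω → E) (Z : Ω' → E) (P : Measure Ω) [IsProbabilityMeasure P]
    (P' : Measure Ω') [IsProbabilityMeasure P'] : Prop :=
  letI : MeasurableSpace E := borel E
  haveI : BorelSpace E := ⟨rfl⟩
  TendstoInDistribution X atTop Z (fun _ => P) P'

end TreeWalk

end

noncomputable section

namespace TreeWalk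

open TreePoint ProbabilityTheory

/-! ### The walk as a Markov chain -/

section Markov

variable {Ω : Type*} [MeasurableSpace Ω] {P : Measure Ω}

/-! The only way the range can fail to look like the tree coded by its height process is
backtracking: the walk goes `k` levels down from a vertex and later climbs back to that same vertex.
The bias makes this exponentially unlikely in `k`.

For a fixed word `z`, the potential `lam ^ |x ∧ z|` is superharmonic away from the root: at an
ancestor of `z`, the pull towards the parent compensates the gain at the one child that leads to
`z`. At the root one step gains at most `lam - 1` (`tsum_transProb_mul_pow_le`). Take `z = Y i` and
start from a time at which the walk is `k` levels below `|Y i|` in height. A return to `Y i` at time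
`l` then has probability at most `lam ^ (-k) * (1 + l * (lam - 1))`. A union bound over times of
order `n` costs only a power of `n`, and this is negligible for `k` of order `a n`, because `log n =
o(a n)` (`IsBiasedWalk.tendsto_measure_backtracks`).

The rest is deterministic. A path between two vertices has to come down to the height of their
common ancestor, and without backtracking it cannot go much lower. So the minimum of the height
between two times is the height of the common ancestor up to `k`, and the tree distance along the
path is uniformly close to the coded pseudo-metric (`IsPath.abs_dist_sub_coded_le`).

To turn this into convergence, each pseudo-metric on `[0, ζ]` is realised as a curve in the
separable Banach space `C([0, ζ], ℝ)` by Kuratowski's embedding. The curve depends continuously on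
the height function, and the GHP class depends continuously on the curve
(`continuous_ofCurve_toGHP`). Continuous mapping, Slutsky's theorem for curves, and continuous
mapping again conclude. -/

/-- A function with countably many values and measurable fibres is measurable for every
sigma-field on its codomain. -/
theorem measurable_of_countable_fibers {α : Type*} [Countable α] [MeasurableSpace α] {X : Ω → α}
    (hX : ∀ x, MeasurableSet {ω | X ω = x}) : Measurable X := by
  intro s _
  have : X ⁻¹' s = ⋃ x ∈ s, {ω | X ω = x} := by ext; simp
  rw [this]
  exact MeasurableSet.biUnion s.to_countable fun x _ => hX x

theorem lintegral_of_countable_fibers {α : Type*} [Countable α] {X : Ω → α}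
    (hX : ∀ x, MeasurableSet {ω | X ω = x}) (g : α → ℝ≥0∞) :
    ∫⁻ ω, g (X ω) ∂P = ∑' x, g x * P {ω | X ω = x} := by
  let _ : MeasurableSpace α := ⊤
  -- With the discrete sigma-field on a countable type, every function `g` is measurable.
  have hX' : Measurable X := measurable_of_countable_fibers hX
  rw [← lintegral_map (measurable_of_countable g) hX', lintegral_countable']
  refine tsum_congr fun x => ?_
  rw [Measure.map_apply hX' (measurableSet_singleton x)]
  rfl

variable {t : OrderedTree} {lam : ℝ} {Y : ℕ → Ω → Vertex t}

/-- The path of the walk up to time `n`. -/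
def history (Y : ℕ → Ω → Vertex t) (n : ℕ) (ω : Ω) : Fin (n + 1) → Vertex t := fun k => Y k ω

theorem IsBiasedWalk.measurableSet_history (hY : IsBiasedWalk P t lam Y) (n : ℕ)
    (p : Fin (n + 1) → Vertex t) : MeasurableSet {ω | history Y n ω = p} := by
  have : {ω | history Y n ω = p} = ⋂ k : Fin (n + 1), {ω | Y k ω = p k} := by
    ext ω; simp [history, funext_iff]
  rw [this]
  exact MeasurableSet.iInter fun k => hY.measurable k (p k)

/-- Reindexes the Markov hypothesis by finite histories: these form a countable type, so integrals
over the past become sums. -/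
theorem IsBiasedWalk.measure_history_step (hY : IsBiasedWalk P t lam Y) (n : ℕ)
    (p : Fin (n + 1) → Vertex t) (y : Vertex t) :
    P {ω | history Y n ω = p ∧ Y (n + 1) ω = y} =
      P {ω | history Y n ω = p} * ENNReal.ofReal (transProb lam (p (Fin.last n)) y) := by
  have h := hY.markov n fun k => if hk : k < n + 1 then p ⟨k, hk⟩ else y
  have e1 : {ω | ∀ k ≤ n + 1, Y k ω = if hk : k < n + 1 then p ⟨k, hk⟩ else y} =
      {ω | history Y n ω = p ∧ Y (n + 1) ω = y} := by
    ext ω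
    simp only [mem_ofPred_eq, history, funext_iff]
    constructor
    · intro H
      refine ⟨fun k => ?_, by simpa using H (n + 1) le_rfl⟩
      simpa [k.2] using H k (by omega)
    · rintro ⟨H, H'⟩ k hk
      split_ifs with hk'
      · exact H ⟨k, hk'⟩
      · rwa [show k = n + 1 by omega]
  have e2 : {ω | ∀ k ≤ n, Y k ω = if hk : k < n + 1 then p ⟨k, hk⟩ else y} =
      {ω | history Y n ω = p} := by
    ext ω
    simp only [mem_ofPred_eq, history, funext_iff]
    constructor
    · intro H k
      simpa [k.2] using H k (by omega)
    · intro H k hk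
      rw [dif_pos (by omega)]
      exact H ⟨k, by omega⟩
  rw [e1, e2] at h
  simpa [Fin.last] using h

theorem IsBiasedWalk.measurableSet_history_prod (hY : IsBiasedWalk P t lam Y) (n : ℕ)
    (x : (Fin (n + 1) → Vertex t) × Vertex t) :
    MeasurableSet {ω | (history Y n ω, Y (n + 1) ω) = x} := by
  simp only [Prod.ext_iff]
  exact (hY.measurableSet_history n x.1).inter (hY.measurable (n + 1) x.2)

/-- The Markov property, in integrated form. -/
theorem IsBiasedWalk.lintegral_step (hY : IsBiasedWalk P t lam Y) (n : ℕ)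
    (F : (Fin (n + 1) → Vertex t) → Vertex t → ℝ≥0∞) :
    ∫⁻ ω, F (history Y n ω) (Y (n + 1) ω) ∂P =
      ∫⁻ ω, ∑' y, ENNReal.ofReal (transProb lam (Y n ω) y) * F (history Y n ω) y ∂P := by
  rw [lintegral_of_countable_fibers (hY.measurableSet_history_prod n) fun x => F x.1 x.2,
    ENNReal.tsum_prod']
  refine Eq.trans ?_ (lintegral_of_countable_fibers (P := P) (hY.measurableSet_history n)
    fun p => ∑' y, ENNReal.ofReal (transProb lam (p (Fin.last n)) y) * F p y).symm
  refine tsum_congr fun p => ?_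
  rw [← ENNReal.tsum_mul_right]
  refine tsum_congr fun y => ?_
  simp only [Prod.mk.injEq]
  rw [hY.measure_history_step]
  ring

/-- Almost surely, the walk moves to a vertex that is reached with positive probability. -/
theorem IsBiasedWalk.ae_adjacent (hY : IsBiasedWalk P t lam Y) :
    ∀ᵐ ω ∂P, ∀ n, IsParent (Y n ω) (Y (n + 1) ω) ∨ IsParent (Y (n + 1) ω) (Y n ω) := by
  classical
  rw [ae_all_iff]
  intro n
  -- The test function is the indicator of a move to a non-neighbour, where `transProb` vanishes.
  have h := hY.lintegral_step n fun p y =>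
    if IsParent (p (Fin.last n)) y ∨ IsParent y (p (Fin.last n)) then 0 else 1
  have h0 : ∀ ω, ∑' y, ENNReal.ofReal (transProb lam (Y n ω) y) *
      (if IsParent (history Y n ω (Fin.last n)) y ∨ IsParent y (history Y n ω (Fin.last n))
        then (0 : ℝ≥0∞) else 1) = 0 := by
    intro ω
    refine ENNReal.tsum_eq_zero.2 fun y => ?_
    split_ifs with h
    · rw [mul_zero]
    · have h1 : ¬ IsParent (Y n ω) y := fun h' => h (Or.inl h')
      have h2 : ¬ IsParent y (Y n ω) := fun h' => h (Or.inr h')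
      simp [transProb, h1, h2]
  simp only [h0, lintegral_zero] at h
  have hm : Measurable fun ω => (if IsParent (history Y n ω (Fin.last n)) (Y (n + 1) ω) ∨
      IsParent (Y (n + 1) ω) (history Y n ω (Fin.last n)) then (0 : ℝ≥0∞) else 1) := by
    let _ : MeasurableSpace ((Fin (n + 1) → Vertex t) × Vertex t) := ⊤
    have h1 : Measurable fun ω => (history Y n ω, Y (n + 1) ω) :=
      measurable_of_countable_fibers (hY.measurableSet_history_prod n)
    exact (measurable_of_countable fun x : (Fin (n + 1) → Vertex t) × Vertex t =>
      if IsParent (x.1 (Fin.last n)) x.2 ∨ IsParent x.2 (x.1 (Fin.last n)) then (0 : ℝ≥0∞)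
        else 1).comp h1
  rw [lintegral_eq_zero_iff hm] at h
  filter_upwards [h] with ω hω
  by_contra hc
  simp [history, hc] at hω

end Markov

/-! ### Ancestors -/

section Drift

variable {t : OrderedTree}

theorem meet_eq_take (u v : List ℕ) : meet u v = u.take (meet u v).length := by
  induction u generalizing v with
  | nil => cases v <;> simp [meet]
  | cons a u ih =>
    cases v with
    | nil => simp [meet]
    | cons b v =>
      by_cases h : a = b
      · subst h; simpa [meet] using ih v
      · simp [meet, h]

theorem length_meet_eq_left_iff (u v : List ℕ) : (meet u v).length = u.length ↔ u <+: v := by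
  rw [List.prefix_iff_eq_take]
  constructor
  · intro h
    have := ((le_length_meet u.length u v).1 h.ge).2.2
    rwa [List.take_length] at this
  · intro h
    refine le_antisymm (length_meet_le_left u v) ((le_length_meet _ _ _).2 ⟨le_rfl, ?_, ?_⟩)
    · have := congrArg List.length h
      rw [List.length_take] at this; omega
    · rw [List.take_length]; exact h

theorem finite_children (x : Vertex t) : {y : Vertex t | IsParent x y}.Finite := by
  obtain ⟨k, hk⟩ := t.children x.1 x.2
  have : ((fun y : Vertex t => y.1) '' {y : Vertex t | IsParent x y}) ⊆
      (fun i => x.1 ++ [i]) '' Icc 1 k := by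
    rintro _ ⟨y, ⟨h1, h2⟩, rfl⟩
    have e : y.1 = x.1 ++ [y.1.getLast h1] := by rw [← h2, List.dropLast_append_getLast]
    exact ⟨_, (hk _).1 (e ▸ y.2), e.symm⟩
  exact Finite.of_finite_image (((finite_Icc 1 k).image _).subset this)
    Subtype.val_injective.injOn

theorem IsParent.eq_append {x y : Vertex t} (h : IsParent x y) : ∃ i, y.1 = x.1 ++ [i] :=
  ⟨y.1.getLast h.1, by
    have h1 := List.dropLast_append_getLast h.1
    simp only [h.2] at h1
    exact h1.symm⟩

theorem IsParent.length {x y : Vertex t} (h : IsParent x y) : y.1.length = x.1.length + 1 := by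
  obtain ⟨i, hi⟩ := h.eq_append
  simp [hi]

theorem IsParent.eq_of_left {x y z : Vertex t} (h : IsParent x z) (h' : IsParent y z) : x = y :=
  Subtype.ext (h.2.symm.trans h'.2)

theorem exists_isParent {x : Vertex t} (h : x.1 ≠ []) : ∃ y, IsParent y x :=
  ⟨⟨_, t.parent_mem _ x.2 h⟩, h, rfl⟩

/-- If `y` is not an ancestor of `z`, the common prefix is shorter than `y`, so it already lies in
the parent. Hence the potential is constant across this edge. -/
theorem IsParent.length_meet_of_not_prefix {x y : Vertex t} (h : IsParent x y) {z : List ℕ}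
    (hz : ¬ y.1 <+: z) : (meet y.1 z).length = (meet x.1 z).length := by
  have h1 : (meet y.1 z).length ≠ y.1.length := fun e => hz ((length_meet_eq_left_iff _ _).1 e)
  have h2 := length_meet_le_left y.1 z
  have h3 := h.length
  have e : x.1 = y.1.take x.1.length := by
    obtain ⟨i, hi⟩ := h.eq_append
    simp [hi]
  have h4 := length_meet_take y.1 z x.1.length z.length
  rw [← e, List.take_length] at h4
  have h5 := length_meet_le_right y.1 z
  omega

theorem IsParent.prefix {x y : Vertex t} (h : IsParent x y) : x.1 <+: y.1 := by
  obtain ⟨i, hi⟩ := h.eq_append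
  exact ⟨[i], hi.symm⟩

/-- At most one child of a vertex is an ancestor of a given word. -/
theorem IsParent.eq_of_prefix {x y y' : Vertex t} (h : IsParent x y) (h' : IsParent x y')
    {z : List ℕ} (hz : y.1 <+: z) (hz' : y'.1 <+: z) : y = y' := by
  refine Subtype.ext ?_
  rw [List.prefix_iff_eq_take.1 hz, List.prefix_iff_eq_take.1 hz', h.length, h'.length]

/-- The sum over the children of `x` of the potential `lam ^ |y ∧ z|`. -/
theorem sum_children_pow_le {lam : ℝ} (hlam : 1 ≤ lam) (x : Vertex t) (z : List ℕ) :
    ∑ y ∈ (finite_children x).toFinset, lam ^ (meet y.1 z).length ≤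
      (numChildren x + (if x.1 <+: z then lam - 1 else 0)) * lam ^ (meet x.1 z).length := by
  classical
  have hcard : (numChildren x : ℝ) = (finite_children x).toFinset.card := by
    rw [numChildren, ncard_eq_toFinset_card _ (finite_children x)]
  have hpos : (0 : ℝ) ≤ lam ^ (meet x.1 z).length := by positivity
  set c := lam ^ (meet x.1 z).length with hc
  -- Only a child that is itself an ancestor of `z` raises the exponent, and it raises it by one:
  -- `lam * c = c + (lam - 1) * c`.
  have key : ∀ y ∈ (finite_children x).toFinset, lam ^ (meet y.1 z).length =
      c + if y.1 <+: z then (lam - 1) * c else 0 := by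
    intro y hy
    have hy : IsParent x y := by simpa using hy
    split_ifs with h
    · have h1 := (length_meet_eq_left_iff _ _).2 h
      have h2 := (length_meet_eq_left_iff _ _).2 (hy.prefix.trans h)
      rw [hc, h1, h2, hy.length]; ring
    · rw [hy.length_meet_of_not_prefix h, add_zero]
  rw [Finset.sum_congr rfl key, Finset.sum_add_distrib, Finset.sum_const, nsmul_eq_mul, ← hcard,
    add_mul]
  refine add_le_add le_rfl ?_
  rw [← Finset.sum_filter]
  have hone : ((finite_children x).toFinset.filter fun y => y.1 <+: z).card ≤
      if x.1 <+: z then 1 else 0 := by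
    split_ifs with h
    · rw [Finset.card_le_one]
      intro y hy y' hy'
      simp only [Finset.mem_filter, Finite.mem_toFinset, mem_ofPred_eq] at hy hy'
      exact hy.1.eq_of_prefix hy'.1 hy.2 hy'.2
    · rw [Nat.le_zero, Finset.card_eq_zero, Finset.filter_eq_empty_iff]
      intro y hy hyz
      have hy : IsParent x y := by simpa using hy
      exact h (hy.prefix.trans hyz)
  rw [Finset.sum_const, nsmul_eq_mul]
  have hone' : (((finite_children x).toFinset.filter fun y => y.1 <+: z).card : ℝ) ≤
      if x.1 <+: z then 1 else 0 := by
    split_ifs with h <;> simp only [h, if_true, if_false] at hone <;> exact_mod_cast hone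
  refine (mul_le_mul_of_nonneg_right hone' (mul_nonneg (by linarith) hpos)).trans ?_
  split_ifs <;> simp

/-- The potential `lam ^ |x ∧ z|` is superharmonic for the walk, except at the root. -/
theorem tsum_transProb_mul_pow_le {lam : ℝ} (hlam : 1 ≤ lam) (x : Vertex t) (z : List ℕ) :
    ∑' y, ENNReal.ofReal (transProb lam x y) * ENNReal.ofReal (lam ^ (meet y.1 z).length) ≤
      ENNReal.ofReal (lam ^ (meet x.1 z).length + (lam - 1)) := by
  classical
  have hl0 : 0 < lam := by linarith
  set C := (finite_children x).toFinset with hC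
  have hmem : ∀ y, y ∈ C ↔ IsParent x y := by simp [hC]
  have hsum := sum_children_pow_le hlam x z
  rw [← hC] at hsum
  have hk0 : (0 : ℝ) ≤ numChildren x := by positivity
  have hsum0 : 0 ≤ ∑ y ∈ C, lam ^ (meet y.1 z).length :=
    Finset.sum_nonneg fun y _ => by positivity
  -- At the root no parent offsets the gain: the mean potential is at most `1 + (lam - 1) /
  -- numChildren x`, whence the additive error in the bound.
  by_cases hx : x.1 = []
  · have hroot : x = rootVertex t := Subtype.ext hx
    have hnp : ∀ y, ¬ IsParent y x := fun y h => h.1 hx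
    have htp : ∀ y, transProb lam x y = if y ∈ C then 1 / (numChildren x : ℝ) else 0 := by
      intro y
      rw [transProb, if_neg (hnp y), if_pos hroot]
      simp only [hmem]
    rw [tsum_eq_sum (s := C) (by intro y hy; simp [htp, hy])]
    have : ∑ y ∈ C, ENNReal.ofReal (transProb lam x y) *
        ENNReal.ofReal (lam ^ (meet y.1 z).length) =
        ENNReal.ofReal ((1 / (numChildren x : ℝ)) * ∑ y ∈ C, lam ^ (meet y.1 z).length) := by
      rw [Finset.mul_sum, ENNReal.ofReal_sum_of_nonneg (fun y _ => by positivity)]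
      refine Finset.sum_congr rfl fun y hy => ?_
      rw [htp, if_pos hy, ENNReal.ofReal_mul (by positivity)]
    rw [this]
    refine ENNReal.ofReal_le_ofReal ?_
    have hm : (meet x.1 z).length = 0 := by
      have := length_meet_le_left x.1 z
      rw [hx] at this ⊢
      simpa using this
    rw [hx, if_pos List.nil_prefix, ← hx, hm, pow_zero, mul_one] at hsum
    rw [hm, pow_zero]
    rcases eq_or_ne (numChildren x) 0 with h0 | h0
    · simp [h0]; linarith
    · have h1 : (1 : ℝ) ≤ numChildren x := by exact_mod_cast Nat.one_le_iff_ne_zero.2 h0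
      rw [one_div, inv_mul_le_iff₀ (by linarith)]
      nlinarith
  · obtain ⟨q, hq⟩ := exists_isParent hx
    have hqC : q ∉ C := by
      rw [hmem]
      intro h
      have := h.length
      have := hq.length
      omega
    have hx' : x ≠ rootVertex t := fun h => hx (by rw [h]; rfl)
    have htp : ∀ y, transProb lam x y = if y = q then lam / (lam + numChildren x) else
        if y ∈ C then 1 / (lam + numChildren x) else 0 := by
      intro y
      have : IsParent y x ↔ y = q := ⟨fun h => h.eq_of_left hq, fun h => h ▸ hq⟩
      simp [transProb, hmem, hx', this]
    rw [tsum_eq_sum (s := insert q C) (by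
      intro y hy
      rw [Finset.mem_insert, not_or] at hy
      simp [htp, hy.1, hy.2])]
    have e : ∑ y ∈ insert q C, ENNReal.ofReal (transProb lam x y) *
        ENNReal.ofReal (lam ^ (meet y.1 z).length) =
        ENNReal.ofReal ((lam * lam ^ (meet q.1 z).length +
          ∑ y ∈ C, lam ^ (meet y.1 z).length) / (lam + numChildren x)) := by
      rw [Finset.sum_insert hqC, add_div, ENNReal.ofReal_add (by positivity) (by positivity)]
      congr 1
      · rw [htp, if_pos rfl, ← ENNReal.ofReal_mul (by positivity)]
        congr 1; ring
      · rw [Finset.sum_div, ENNReal.ofReal_sum_of_nonneg (fun y _ => by positivity)]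
        refine Finset.sum_congr rfl fun y hy => ?_
        rw [htp, if_neg (fun h : y = q => hqC (h ▸ hy)), if_pos hy, ← ENNReal.ofReal_mul (by positivity)]
        congr 1; ring
    rw [e]
    refine ENNReal.ofReal_le_ofReal ?_
    rw [div_le_iff₀ (by positivity)]
    have hlast : (0 : ℝ) ≤ (lam - 1) * (lam + numChildren x) :=
      mul_nonneg (by linarith) (by positivity)
    -- At an ancestor of `z`, the parent contributes `lam * lam ^ (|x| - 1) = lam ^ |x|`, and the
    -- children add at most `numChildren x + lam - 1` times `lam ^ |x|`. Otherwise the parent and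
    -- all children have the same potential as `x`.
    split_ifs at hsum with h
    · have h1 := (length_meet_eq_left_iff _ _).2 h
      have h2 := (length_meet_eq_left_iff _ _).2 (hq.prefix.trans h)
      rw [h1] at hsum ⊢
      rw [h2]
      have h3 : lam * lam ^ q.1.length = lam ^ x.1.length := by rw [hq.length]; ring
      nlinarith
    · rw [← hq.length_meet_of_not_prefix h]
      nlinarith

end Drift

/-! ### Backtracking -/

section Backtracking

variable {t : OrderedTree}

/-- Up to time `N`, the path `y` goes down by at least `k` levels from some vertex, and then
returns to this vertex. -/
def Backtracks (y : ℕ → Vertex t) (k N : ℕ) : Prop :=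
  ∃ i j l, i ≤ j ∧ j ≤ l ∧ l ≤ N ∧ y l = y i ∧ (y j).1.length + k ≤ (y i).1.length

variable {Ω : Type*} [MeasurableSpace Ω] {P : Measure Ω}
  {lam : ℝ} {Y : ℕ → Ω → Vertex t}

/-- The target `Y i` is known at time `j`, so the superharmonic bound can be iterated from `j` on
with `z = Y i` frozen. Dividing by `lam ^ |Y i|` normalises the potential to `1` at a return, and
each step costs at most `lam ^ (-k) * (lam - 1)`. -/
theorem IsBiasedWalk.lintegral_potential_le [IsProbabilityMeasure P]
    (hY : IsBiasedWalk P t lam Y) (hlam : 1 ≤ lam) {i j : ℕ} (hij : i ≤ j) (k d : ℕ) :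
    ∫⁻ ω, (if (Y j ω).1.length + k ≤ (Y i ω).1.length
        then ENNReal.ofReal (lam ^ (Y i ω).1.length)⁻¹ else 0) *
      ENNReal.ofReal (lam ^ (meet (Y (j + d) ω).1 (Y i ω).1).length) ∂P ≤
      ENNReal.ofReal (lam ^ k)⁻¹ * (1 + d * ENNReal.ofReal (lam - 1)) := by
  have hl0 : 0 < lam := by linarith
  -- On this event `|Y i| ≥ k`, so the normalising weight is at most `lam ^ (-k)`.
  have hpow : ∀ ω, (if (Y j ω).1.length + k ≤ (Y i ω).1.length
      then ENNReal.ofReal (lam ^ (Y i ω).1.length)⁻¹ else 0) ≤ ENNReal.ofReal (lam ^ k)⁻¹ := by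
    intro ω
    split_ifs with h
    · refine ENNReal.ofReal_le_ofReal (inv_anti₀ (by positivity) ?_)
      exact pow_le_pow_right₀ hlam (by omega)
    · simp
  induction d with
  | zero =>
    refine (lintegral_mono (g := fun _ => ENNReal.ofReal (lam ^ k)⁻¹) fun ω => ?_).trans ?_
    · simp only [add_zero]
      split_ifs with h
      · rw [← ENNReal.ofReal_mul (by positivity)]
        refine ENNReal.ofReal_le_ofReal ?_
        rw [inv_mul_le_iff₀ (by positivity), ← div_eq_mul_inv, le_div_iff₀ (by positivity),
          ← pow_add]
        have := length_meet_le_left (Y j ω).1 (Y i ω).1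
        exact pow_le_pow_right₀ hlam (by omega)
      · simp
    · simp
  | succ d ih =>
    have step := hY.lintegral_step (j + d) fun p y =>
      (if (p ⟨j, by omega⟩).1.length + k ≤ (p ⟨i, by omega⟩).1.length
        then ENNReal.ofReal (lam ^ (p ⟨i, by omega⟩).1.length)⁻¹ else 0) *
        ENNReal.ofReal (lam ^ (meet y.1 (p ⟨i, by omega⟩).1).length)
    refine (step.trans_le (lintegral_mono (g := fun ω =>
      (if (Y j ω).1.length + k ≤ (Y i ω).1.length
        then ENNReal.ofReal (lam ^ (Y i ω).1.length)⁻¹ else 0) *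
      ENNReal.ofReal (lam ^ (meet (Y (j + d) ω).1 (Y i ω).1).length) +
      ENNReal.ofReal (lam ^ k)⁻¹ * ENNReal.ofReal (lam - 1)) fun ω => ?_)).trans ?_
    · simp only [history]
      simp_rw [mul_left_comm (ENNReal.ofReal (transProb lam _ _))]
      rw [ENNReal.tsum_mul_left]
      refine (mul_le_mul_right (tsum_transProb_mul_pow_le hlam _ _) _).trans ?_
      rw [ENNReal.ofReal_add (by positivity) (by linarith), mul_add]
      exact add_le_add le_rfl (mul_le_mul_left (hpow ω) _)
    · rw [lintegral_add_right _ measurable_const, lintegral_const, measure_univ, mul_one]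
      refine (add_le_add ih le_rfl).trans (le_of_eq ?_)
      push_cast
      ring

theorem IsBiasedWalk.measurableSet_of_history (hY : IsBiasedWalk P t lam Y) (n : ℕ)
    (S : Set (Fin (n + 1) → Vertex t)) : MeasurableSet {ω | history Y n ω ∈ S} := by
  let _ : MeasurableSpace (Fin (n + 1) → Vertex t) := ⊤
  exact measurable_of_countable_fibers (hY.measurableSet_history n) (MeasurableSet.of_discrete)

/-- On the event the normalised potential at time `l` equals `1`, so its expectation dominates the
probability. -/
theorem IsBiasedWalk.measure_return_le [IsProbabilityMeasure P]
    (hY : IsBiasedWalk P t lam Y) (hlam : 1 ≤ lam) {i j l : ℕ} (hij : i ≤ j) (hjl : j ≤ l) (k : ℕ) :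
    P {ω | Y l ω = Y i ω ∧ (Y j ω).1.length + k ≤ (Y i ω).1.length} ≤
      ENNReal.ofReal (lam ^ k)⁻¹ * (1 + l * ENNReal.ofReal (lam - 1)) := by
  have hl0 : 0 < lam := by linarith
  have hm : MeasurableSet {ω | Y l ω = Y i ω ∧ (Y j ω).1.length + k ≤ (Y i ω).1.length} :=
    hY.measurableSet_of_history l {p | p ⟨l, by omega⟩ = p ⟨i, by omega⟩ ∧
      (p ⟨j, by omega⟩).1.length + k ≤ (p ⟨i, by omega⟩).1.length}
  rw [← lintegral_indicator_one hm]
  obtain ⟨d, rfl⟩ := Nat.exists_eq_add_of_le hjl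
  refine (lintegral_mono fun ω => ?_).trans
    ((hY.lintegral_potential_le hlam hij k d).trans ?_)
  · by_cases hω : ω ∈ {ω | Y (j + d) ω = Y i ω ∧ (Y j ω).1.length + k ≤ (Y i ω).1.length}
    swap
    · rw [indicator_of_notMem hω]; exact zero_le
    rw [indicator_of_mem hω, if_pos hω.2, hω.1, length_meet_self, ← ENNReal.ofReal_mul (by positivity),
      inv_mul_cancel₀ (by positivity)]
    simp
  · gcongr
    omega

/-- Union bound over the triples of times `(i, j, l)`; this polynomial loss is harmless when `k` is
large compared with `log N`. -/
theorem IsBiasedWalk.measure_backtracks_le [IsProbabilityMeasure P]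
    (hY : IsBiasedWalk P t lam Y) (hlam : 1 ≤ lam) (k N : ℕ) :
    P {ω | Backtracks (fun n => Y n ω) k N} ≤
      (N + 1) ^ 3 * (ENNReal.ofReal (lam ^ k)⁻¹ * (1 + N * ENNReal.ofReal (lam - 1))) := by
  set R := Finset.range (N + 1) with hR
  have hsub : {ω | Backtracks (fun n => Y n ω) k N} ⊆ ⋃ x ∈ R ×ˢ R ×ˢ R,
      {ω | x.1 ≤ x.2.1 ∧ x.2.1 ≤ x.2.2 ∧ Y x.2.2 ω = Y x.1 ω ∧
        (Y x.2.1 ω).1.length + k ≤ (Y x.1 ω).1.length} := by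
    rintro ω ⟨i, j, l, h1, h2, h3, h4⟩
    refine mem_biUnion (x := (i, j, l)) ?_ ⟨h1, h2, h4⟩
    simp only [hR, Finset.coe_product, Finset.coe_range, mem_prod, mem_Iio]
    omega
  refine (measure_mono hsub).trans ((measure_biUnion_finset_le _ _).trans ?_)
  refine (Finset.sum_le_card_nsmul _ _
    (ENNReal.ofReal (lam ^ k)⁻¹ * (1 + N * ENNReal.ofReal (lam - 1))) ?_).trans (le_of_eq ?_)
  · rintro ⟨i, j, l⟩ hx
    simp only [hR, Finset.mem_product, Finset.mem_range] at hx
    by_cases h : i ≤ j ∧ j ≤ l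
    · refine (measure_mono fun ω hω => hω.2.2).trans
        ((hY.measure_return_le hlam h.1 h.2 k).trans ?_)
      gcongr
      omega
    · refine (measure_mono_null (fun ω hω => (h ⟨hω.1, hω.2.1⟩).elim) measure_empty).trans_le ?_
      exact zero_le
  · rw [nsmul_eq_mul, Finset.card_product, Finset.card_product, hR, Finset.card_range]
    push_cast
    ring

end Backtracking

/-! ### Nearest neighbour paths -/

section Paths

variable {t : OrderedTree}

/-- Paths that move along the edges of the tree. -/
def IsPath (y : ℕ → Vertex t) : Prop :=
  ∀ n, IsParent (y n) (y (n + 1)) ∨ IsParent (y (n + 1)) (y n)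

theorem exists_switch {p : ℕ → Prop} {i i' : ℕ} (h : i ≤ i') (hi : p i) (hi' : ¬ p i') :
    ∃ j, i ≤ j ∧ j < i' ∧ p j ∧ ¬ p (j + 1) := by
  induction i', h using Nat.le_induction with
  | base => exact (hi' hi).elim
  | succ n hn ih =>
    by_cases hp : p n
    · exact ⟨n, hn, n.lt_succ_self, hp, hi'⟩
    · obtain ⟨j, h1, h2, h3⟩ := ih hp
      exact ⟨j, h1, h2.trans n.lt_succ_self, h3⟩

theorem IsParent.eq_of_prefix_of_not_prefix {x y : Vertex t} (h : IsParent x y) {w : List ℕ}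
    (hy : w <+: y.1) (hx : ¬ w <+: x.1) : y.1 = w := by
  obtain ⟨i, hi⟩ := h.eq_append
  rw [hi, List.prefix_concat_iff] at hy
  rw [hi]
  exact (hy.resolve_right hx).symm

/-- A path that leaves the subtree above `w` does so by a step from `w` to its parent. -/
theorem IsPath.exists_exit {y : ℕ → Vertex t} (hy : IsPath y) {i i' : ℕ} (h : i ≤ i')
    {w : List ℕ} (hi : w <+: (y i).1) (hi' : ¬ w <+: (y i').1) :
    ∃ j, i ≤ j ∧ j < i' ∧ (y j).1 = w ∧ IsParent (y (j + 1)) (y j) := by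
  obtain ⟨j, h1, h2, h3, h4⟩ := exists_switch (p := fun j => w <+: (y j).1) h hi hi'
  have hp := (hy j).resolve_left fun hp => h4 (h3.trans hp.prefix)
  exact ⟨j, h1, h2, hp.eq_of_prefix_of_not_prefix h3 h4, hp⟩

/-- A path that enters the subtree above `w` does so at `w`. -/
theorem IsPath.exists_enter {y : ℕ → Vertex t} (hy : IsPath y) {i i' : ℕ} (h : i ≤ i')
    {w : List ℕ} (hi : ¬ w <+: (y i).1) (hi' : w <+: (y i').1) :
    ∃ j, i ≤ j ∧ j ≤ i' ∧ (y j).1 = w := by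
  obtain ⟨j, h1, h2, h3, h4⟩ :=
    exists_switch (p := fun j => ¬ w <+: (y j).1) h hi (not_not.2 hi')
  rw [not_not] at h4
  have hp := (hy j).resolve_right fun hp => h3 (h4.trans hp.prefix)
  exact ⟨j + 1, by omega, h2, hp.eq_of_prefix_of_not_prefix h4 h3⟩

/-- The ancestor of `y i` one level above the common ancestor is not an ancestor of `y i'`, so the
path must leave its subtree, and it does so through the common ancestor. -/
theorem IsPath.exists_length_le_meet {y : ℕ → Vertex t} (hy : IsPath y) {i i' : ℕ}
    (h : i ≤ i') : ∃ j, i ≤ j ∧ j ≤ i' ∧ (y j).1.length ≤ (meet (y i).1 (y i').1).length := by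
  rcases le_or_gt (y i).1.length (meet (y i).1 (y i').1).length with h0 | h0
  · exact ⟨i, le_rfl, h, h0⟩
  · set m := (meet (y i).1 (y i').1).length with hm
    have hlen : ((y i).1.take (m + 1)).length = m + 1 := by rw [List.length_take]; omega
    have hnot : ¬ (y i).1.take (m + 1) <+: (y i').1 := by
      intro hp
      have h1 := List.prefix_iff_eq_take.1 hp
      have h2 := hp.length_le
      rw [hlen] at h1 h2
      have := (le_length_meet (m + 1) (y i).1 (y i').1).2 ⟨h0, h2, h1⟩
      omega
    obtain ⟨j, h1, h2, h3, h4⟩ := hy.exists_exit h (List.take_prefix _ _) hnot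
    refine ⟨j + 1, by omega, h2, ?_⟩
    have := h4.length
    rw [h3, hlen] at this
    omega

/-- If the path were `k` levels below the common ancestor `z` at time `j`, it would have left the
subtree of `z` before and re-entered it after, each time through `z` itself: a backtrack from `z`.
-/
theorem IsPath.length_meet_lt {y : ℕ → Vertex t} (hy : IsPath y) {k N : ℕ}
    (hb : ¬ Backtracks y k N) {i j i' : ℕ} (hij : i ≤ j) (hji : j ≤ i') (hN : i' ≤ N) :
    (meet (y i).1 (y i').1).length < (y j).1.length + k := by
  by_contra hc
  rw [not_lt] at hc
  -- For `k = 0` backtracking is automatic; `k > 0` makes `y j` strictly shorter than `z`.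
  have hk : k ≠ 0 := by
    rintro rfl
    exact hb ⟨0, 0, 0, le_rfl, le_rfl, Nat.zero_le _, rfl, le_rfl⟩
  set z := meet (y i).1 (y i').1 with hz
  have h1 : z <+: (y i).1 := by rw [hz, meet_eq_take]; exact List.take_prefix _ _
  have h2 : z <+: (y i').1 := by
    rw [hz, meet_eq_take, ((le_length_meet _ _ _).1 le_rfl).2.2]; exact List.take_prefix _ _
  have h3 : ¬ z <+: (y j).1 := fun hp => by have := hp.length_le; omega
  obtain ⟨l, a1, a2, a3, -⟩ := hy.exists_exit hij h1 h3
  obtain ⟨l', b1, b2, b3⟩ := hy.exists_enter hji h3 h2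
  exact hb ⟨l, j, l', a2.le, b1, b2.trans hN, Subtype.ext (b3.trans a3.symm), by rwa [a3]⟩

/-! ### Distances and heights along the interpolated path -/

theorem dist_ofVertex (x y : Vertex t) : dist (ofVertex x) (ofVertex y) = vdist x y := by
  rw [← geodesic_zero x y, ← geodesic_vdist x y,
    dist_geodesic x y le_rfl (vdist_nonneg x y) le_rfl, sub_zero]

theorem dist_ofVertex_root (p : TreePoint t) : dist (ofVertex (rootVertex t)) p = p.height := by
  have h0 : 0 ≤ p.height := by
    have h1 := p.frac_pos
    rcases eq_or_ne p.word [] with h | h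
    · simp [height, h, p.frac_root h]
    · have : (1 : ℝ) ≤ p.word.length := by
        exact_mod_cast List.length_pos_iff.2 h
      rw [height]; linarith
  have h1 : (ofVertex (rootVertex t)).height = 0 := by simp [height, ofVertex, rootVertex]
  have h2 : (ofVertex (rootVertex t)).meetHeight p = 0 := by
    rw [meetHeight, h1, min_eq_left h0, min_eq_left (by positivity)]
  rw [dist_def, h1, h2]; ring

theorem height_ofVertex (x : Vertex t) : (ofVertex x).height = x.1.length := by
  simp [height, ofVertex]

theorem IsParent.vdist_eq_one {x y : Vertex t} (h : IsParent x y) : vdist x y = 1 := by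
  rw [vdist, (length_meet_eq_left_iff _ _).2 h.prefix, h.length]
  push_cast; ring

theorem vdist_comm (x y : Vertex t) : vdist x y = vdist y x := by
  rw [vdist, vdist, length_meet_comm]; ring

theorem IsPath.vdist_eq_one {y : ℕ → Vertex t} (hy : IsPath y) (n : ℕ) :
    vdist (y n) (y (n + 1)) = 1 := by
  rcases hy n with h | h
  · exact h.vdist_eq_one
  · rw [vdist_comm]; exact h.vdist_eq_one

theorem IsPath.dist_interp_floor {y : ℕ → Vertex t} (hy : IsPath y) {r : ℝ} (hr : 0 ≤ r) :
    dist (ofVertex (y ⌊r⌋₊)) (interp y r) ≤ 1 := by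
  have h1 := Nat.floor_le hr
  have h2 := Nat.lt_floor_add_one r
  rw [interp, hy.vdist_eq_one, mul_one, ← geodesic_zero (y ⌊r⌋₊) (y (⌊r⌋₊ + 1)),
    dist_geodesic _ _ le_rfl (by linarith) (by rw [hy.vdist_eq_one]; linarith)]
  linarith

theorem IsPath.abs_height_interp_sub_le {y : ℕ → Vertex t} (hy : IsPath y) {r : ℝ}
    (hr : 0 ≤ r) : |(interp y r).height - (y ⌊r⌋₊).1.length| ≤ 1 := by
  rw [← height_ofVertex, ← dist_ofVertex_root, ← dist_ofVertex_root, dist_comm _ (interp y r),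
    dist_comm _ (ofVertex (y ⌊r⌋₊))]
  refine (abs_dist_sub_le _ _ _).trans ?_
  rw [dist_comm]
  exact hy.dist_interp_floor hr

theorem rescaledHeight_apply (y : ℕ → Vertex t) (ζ : ℝ) (n : ℕ) (a : ℝ) (s : Icc (0 : ℝ) ζ) :
    rescaledHeight y ζ n a s = (1 / a) * (interp y (n * s)).height := by
  rw [← dist_ofVertex_root]; rfl

/-- If a path does not backtrack much, the tree distance along the path is close to the
pseudo-metric coded by its height process. -/
theorem IsPath.abs_dist_sub_coded_le {y : ℕ → Vertex t} (hy : IsPath y) {k N : ℕ}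
    (hb : ¬ Backtracks y k N) {ζ : ℝ} {n : ℕ} (hN : n * ζ ≤ N) {a : ℝ} (ha : 0 < a)
    (s s' : Icc (0 : ℝ) ζ) :
    |(1 / a) * dist (interp y (n * s)) (interp y (n * s')) -
      (codedPseudoMetric (rescaledHeight y ζ n a)).d s s'| ≤ (1 / a) * (2 * k + 6) := by
  wlog hss : s ≤ s' generalizing s s'
  · rw [dist_comm, (codedPseudoMetric _).symm]
    exact this s' s (le_of_not_ge hss)
  have ha' : 0 < 1 / a := one_div_pos.2 ha
  have hn : (0 : ℝ) ≤ n := Nat.cast_nonneg n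
  have hs0 : 0 ≤ (n : ℝ) * s := mul_nonneg hn s.2.1
  have hs0' : 0 ≤ (n : ℝ) * s' := mul_nonneg hn s'.2.1
  set i := ⌊(n : ℝ) * s⌋₊ with hi
  set i' := ⌊(n : ℝ) * s'⌋₊ with hi'
  have hii : i ≤ i' := Nat.floor_le_floor (mul_le_mul_of_nonneg_left hss hn)
  have hiN : i' ≤ N :=
    Nat.floor_le_of_le ((mul_le_mul_of_nonneg_left s'.2.2 hn).trans hN)
  set m := (meet (y i).1 (y i').1).length with hm
  have hlow : (1 / a) * (m - k - 1) ≤ minBetween (rescaledHeight y ζ n a) s s' := by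
    refine le_minBetween _ fun u hu => ?_
    rw [uIcc_of_le hss] at hu
    rw [rescaledHeight_apply]
    refine mul_le_mul_of_nonneg_left ?_ ha'.le
    have h1 := hy.abs_height_interp_sub_le (mul_nonneg hn u.2.1)
    have h2 := hy.length_meet_lt hb (j := ⌊(n : ℝ) * u⌋₊)
      (Nat.floor_le_floor (mul_le_mul_of_nonneg_left hu.1 hn))
      (Nat.floor_le_floor (mul_le_mul_of_nonneg_left hu.2 hn)) hiN
    have h3 : (m : ℝ) < (y ⌊(n : ℝ) * u⌋₊).1.length + k := by exact_mod_cast h2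
    rw [abs_le] at h1
    linarith
  have hup : minBetween (rescaledHeight y ζ n a) s s' ≤ (1 / a) * (m + 1) := by
    obtain ⟨j, h1, h2, h3⟩ := hy.exists_length_le_meet hii
    have h3' : ((y j).1.length : ℝ) ≤ m := by exact_mod_cast h3
    -- The natural choice `j / n` can fall before `s` when `j = i`; there `u = s` serves instead.
    obtain ⟨u, hu, huj⟩ : ∃ u ∈ uIcc s s', ⌊(n : ℝ) * u⌋₊ = j := by
      rw [uIcc_of_le hss]
      rcases h1.eq_or_lt with h | h
      · exact ⟨s, left_mem_Icc.2 hss, h⟩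
      · have hn0 : (0 : ℝ) < n := by
          refine hn.lt_of_ne fun h0 => ?_
          rw [← h0, zero_mul, Nat.floor_zero] at hi'
          omega
        have a1 : (s : ℝ) ≤ j / n := by
          rw [le_div_iff₀ hn0, mul_comm]
          exact ((Nat.floor_lt hs0).1 h).le
        have a2 : (j : ℝ) / n ≤ s' := by
          rw [div_le_iff₀ hn0, mul_comm]
          exact (Nat.le_floor_iff hs0').1 h2
        refine ⟨⟨j / n, s.2.1.trans a1, a2.trans s'.2.2⟩, ⟨a1, a2⟩, ?_⟩
        simp only
        rw [mul_div_cancel₀ _ hn0.ne', Nat.floor_natCast]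
    refine (minBetween_le _ hu).trans ?_
    rw [rescaledHeight_apply]
    refine mul_le_mul_of_nonneg_left ?_ ha'.le
    have h4 := hy.abs_height_interp_sub_le (mul_nonneg hn u.2.1)
    rw [huj, abs_le] at h4
    linarith
  have e : (codedPseudoMetric (rescaledHeight y ζ n a)).d s s' =
      (1 / a) * (interp y (n * s)).height + (1 / a) * (interp y (n * s')).height -
        2 * minBetween (rescaledHeight y ζ n a) s s' := by
    rw [← rescaledHeight_apply, ← rescaledHeight_apply]; rfl
  have hd := dist_dist_dist_le (interp y (n * s)) (interp y (n * s'))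
    (ofVertex (y i)) (ofVertex (y i'))
  have b1 := hy.dist_interp_floor hs0
  have b2 := hy.dist_interp_floor hs0'
  rw [dist_comm] at b1 b2
  rw [dist_ofVertex, vdist, Real.dist_eq, ← hm] at hd
  have b3 := hy.abs_height_interp_sub_le hs0
  have b4 := hy.abs_height_interp_sub_le hs0'
  rw [abs_le] at b3 b4
  have hd' := abs_le.1 (hd.trans (add_le_add b1 b2))
  rw [e]
  set q := minBetween (rescaledHeight y ζ n a) s s' with hq
  -- In unscaled units the error `2 * k + 6` is 2 from the distance, 1 from each of the two heights,
  -- and `2 * (k + 1)` from twice the minimum.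
  obtain ⟨q', hq'⟩ : ∃ q', q = (1 / a) * q' := ⟨a * q, by field_simp⟩
  rw [hq'] at hlow hup ⊢
  replace hlow := le_of_mul_le_mul_left hlow ha'
  replace hup := le_of_mul_le_mul_left hup ha'
  have hk : (0 : ℝ) ≤ k := Nat.cast_nonneg k
  rw [show (1 / a) * dist (interp y (n * s)) (interp y (n * s')) -
    ((1 / a) * (interp y (n * s)).height + (1 / a) * (interp y (n * s')).height -
        2 * ((1 / a) * q')) = (1 / a) * (dist (interp y (n * s)) (interp y (n * s')) -
    ((interp y (n * s)).height + (interp y (n * s')).height - 2 * q')) by ring, abs_mul,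
    abs_of_pos ha']
  refine mul_le_mul_of_nonneg_left (abs_le.2 ⟨?_, ?_⟩) ha'.le <;> linarith

end Paths

/-! ### Curves and the Gromov-Hausdorff-Prokhorov topology -/

theorem PMSpace.toGHP_eq {X Y : PMSpace} (f : X.carrier → Y.carrier) (hf : Isometry f)
    (hs : Function.Surjective f) (h0 : f X.root = Y.root) (hm : X.measure.map f = Y.measure) :
    X.toGHP = Y.toGHP :=
  Quotient.sound ⟨⟨Equiv.ofBijective f ⟨hf.injective, hs⟩, hf⟩, h0, hm⟩

namespace ContPseudoMetric

variable {ζ : ℝ}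

/-- The factorisation of `f` through the quotient by a pseudo-metric, if `f` is isometric. -/
def lift {E : Type*} [MetricSpace E] (D : ContPseudoMetric ζ) (hζ : 0 < ζ) (f : Icc (0 : ℝ) ζ → E)
    (hf : ∀ s s', dist (f s) (f s') = D.d s s') :
    (D.space hζ).carrier → E :=
  Quotient.lift f fun s s' h => dist_eq_zero.1 ((hf s s').trans h)

theorem isometry_lift {E : Type*} [MetricSpace E] (D : ContPseudoMetric ζ)
    (hζ : 0 < ζ) (f : Icc (0 : ℝ) ζ → E) (hf : ∀ s s', dist (f s) (f s') = D.d s s') :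
    Isometry (D.lift hζ f hf) := by
  refine Isometry.of_dist_eq ?_
  rintro ⟨s⟩ ⟨s'⟩
  exact hf s s'

theorem range_lift {E : Type*} [MetricSpace E] (D : ContPseudoMetric ζ)
    (hζ : 0 < ζ) (f : Icc (0 : ℝ) ζ → E) (hf : ∀ s s', dist (f s) (f s') = D.d s s') :
    range (D.lift hζ f hf) = range f :=
  range_quot_lift _

theorem map_lift_measure {E : Type*} [MetricSpace E] [MeasurableSpace E] [BorelSpace E]
    (D : ContPseudoMetric ζ) (hζ : 0 < ζ) (f : Icc (0 : ℝ) ζ → E)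
    (hf : ∀ s s', dist (f s) (f s') = D.d s s') :
    (D.space hζ).measure.map (D.lift hζ f hf) = (lebesgue ζ).map f :=
  Measure.map_map (D.isometry_lift hζ f hf).continuous.measurable D.continuous_proj.measurable

/-- Recognises a concrete space as a quotient of `[0, ζ]` from a parametrisation of it; this serves
both for the range of the walk and for the Kuratowski curve. -/
theorem space_toGHP_eq (D : ContPseudoMetric ζ) (hζ : 0 < ζ) (X : PMSpace)
    (f : Icc (0 : ℝ) ζ → X.carrier) (hf : ∀ s s', dist (f s) (f s') = D.d s s')
    (hs : Function.Surjective f) (h0 : f ⟨0, le_rfl, hζ.le⟩ = X.root)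
    (hm : (lebesgue ζ).map f = X.measure) : (D.space hζ).toGHP = X.toGHP := by
  refine PMSpace.toGHP_eq (D.lift hζ f hf) (D.isometry_lift hζ f hf) ?_ h0 ?_
  · exact range_eq_univ.1 ((D.range_lift hζ f hf).trans (range_eq_univ.2 hs))
  · rw [← hm]; exact D.map_lift_measure hζ f hf

/-! ### Kuratowski curves and continuity of the GHP class -/

/-- The pseudo-metric induced by a curve in a metric space. -/
def ofCurve {E : Type*} [MetricSpace E] (κ : C(Icc (0 : ℝ) ζ, E)) : ContPseudoMetric ζ where
  d s s' := dist (κ s) (κ s')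
  self _ := dist_self _
  symm _ _ := dist_comm _ _
  triangle _ _ _ := dist_triangle _ _ _
  continuous := by fun_prop

theorem ofCurve_d {E : Type*} [MetricSpace E] (κ : C(Icc (0 : ℝ) ζ, E)) (s s' : Icc (0 : ℝ) ζ) :
    dist (κ s) (κ s') = (ofCurve κ).d s s' := rfl

/-- Kuratowski's embedding of a pseudo-metric on `[0, ζ]`, as a curve. -/
def curve (D : ContPseudoMetric ζ) : C(Icc (0 : ℝ) ζ, C(Icc (0 : ℝ) ζ, ℝ)) :=
  ContinuousMap.curry ⟨fun p => D.d p.1 p.2, D.continuous⟩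

theorem curve_apply (D : ContPseudoMetric ζ) (s u : Icc (0 : ℝ) ζ) : D.curve s u = D.d s u := rfl

/-- The triangle inequality bounds `|D.d s u - D.d s' u|` by `D.d s s'`, and `u = s'` attains it. -/
theorem dist_curve (D : ContPseudoMetric ζ) (s s' : Icc (0 : ℝ) ζ) :
    dist (D.curve s) (D.curve s') = D.d s s' := by
  refine le_antisymm ((ContinuousMap.dist_le (D.nonneg s s')).2 fun u => ?_) ?_
  · rw [curve_apply, curve_apply, Real.dist_eq, abs_le]
    have h1 := D.triangle s s' u
    have h2 := D.triangle s' s u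
    rw [D.symm s' s] at h2
    constructor <;> linarith
  · have h := ContinuousMap.dist_apply_le_dist (f := D.curve s) (g := D.curve s') s'
    rwa [curve_apply, curve_apply, D.self, Real.dist_eq, sub_zero,
      abs_of_nonneg (D.nonneg s s')] at h

theorem ofCurve_curve_toGHP (D : ContPseudoMetric ζ) (hζ : 0 < ζ) :
    ((ofCurve D.curve).space hζ).toGHP = (D.space hζ).toGHP :=
  space_toGHP_eq _ hζ (D.space hζ) D.proj (fun s s' => (D.dist_curve s s').symm)
    (fun q => Quotient.exists_rep q) rfl rfl

/-- Both spaces already sit in `E`, and the parameter `s` matches their points, roots and measures,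
the last being images of the same Lebesgue measure. The Hausdorff, root and Prokhorov terms each
cost `δ`. -/
theorem ghpDist_ofCurve_le {E : Type} [MetricSpace E] [CompleteSpace E]
    [TopologicalSpace.SeparableSpace E] (hζ : 0 < ζ) (κ κ' : C(Icc (0 : ℝ) ζ, E)) {δ : ℝ≥0∞}
    (h : ∀ s, edist (κ s) (κ' s) ≤ δ) :
    ghpDist ((ofCurve κ).space hζ) ((ofCurve κ').space hζ) ≤ δ + δ + δ := by
  let _ : MeasurableSpace E := borel E
  have _ : BorelSpace E := ⟨rfl⟩
  have key : ∀ (κ κ' : C(Icc (0 : ℝ) ζ, E)), (∀ s, edist (κ s) (κ' s) ≤ δ) →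
      ∀ (ε : ℝ≥0∞) (B : Set E), δ < ε → ε < ⊤ → MeasurableSet B →
      (lebesgue ζ).map κ B ≤ (lebesgue ζ).map κ' (Metric.thickening ε.toReal B) + ε := by
    intro κ κ' h ε B h1 h2 hB
    rw [Measure.map_apply κ.continuous.measurable hB,
      Measure.map_apply κ'.continuous.measurable Metric.isOpen_thickening.measurableSet]
    refine le_add_right (measure_mono fun s hs => ?_)
    rw [mem_preimage, Metric.mem_thickening_iff_exists_edist_lt]
    refine ⟨κ s, hs, ?_⟩
    rw [ENNReal.ofReal_toReal h2.ne, edist_comm]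
    exact (h s).trans_lt h1
  refine le_trans (sInf_le ⟨E, inferInstance, inferInstance, inferInstance, inferInstance,
    inferInstance, lift _ hζ κ (ofCurve_d κ), lift _ hζ κ' (ofCurve_d κ'),
    isometry_lift _ _ _ _, isometry_lift _ _ _ _, rfl⟩) ?_
  refine add_le_add (add_le_add ?_ (h _)) ?_
  · rw [range_lift, range_lift]
    refine Metric.hausdorffEDist_le_of_mem_edist ?_ ?_
    · rintro _ ⟨s, rfl⟩
      exact ⟨_, mem_range_self s, h s⟩
    · rintro _ ⟨s, rfl⟩
      exact ⟨_, mem_range_self s, (edist_comm _ _).trans_le (h s)⟩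
  · rw [map_lift_measure, map_lift_measure]
    exact levyProkhorovEDist_le_of_forall _ _ _ fun ε B h1 h2 hB =>
      ⟨key κ κ' h ε B h1 h2 hB,
        key κ' κ (fun s => (edist_comm _ _).trans_le (h s)) ε B h1 h2 hB⟩

theorem continuous_ofCurve_toGHP {E : Type} [MetricSpace E] [CompleteSpace E]
    [TopologicalSpace.SeparableSpace E] (hζ : 0 < ζ) :
    Continuous fun κ : C(Icc (0 : ℝ) ζ, E) => ((ofCurve κ).space hζ).toGHP := by
  refine continuous_def.2 fun U hU => Metric.isOpen_iff.2 fun κ hκ => ?_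
  obtain ⟨ε, hε, h⟩ := hU _ hκ
  obtain ⟨r, hr, hrε⟩ : ∃ r : ℝ≥0∞, 0 < r ∧ r + r + r < ε := by
    rcases eq_or_ne ε ⊤ with rfl | hne
    · exact ⟨1, one_pos, by norm_num [lt_top_iff_ne_top]⟩
    · refine ⟨ε / 4, ENNReal.div_pos hε.ne' (by norm_num), ?_⟩
      lift ε to NNReal using hne
      have hε' : 0 < ε := by exact_mod_cast hε
      have e : (ε : ℝ≥0∞) / 4 = ((ε / 4 : NNReal) : ℝ≥0∞) := by
        rw [ENNReal.coe_div (by norm_num)]; rfl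
      rw [e]
      norm_cast
      rw [← NNReal.coe_lt_coe]
      push_cast
      have : (0 : ℝ) < ε := hε'
      linarith
  have hr' : r ≠ ⊤ := by
    rintro rfl
    simp at hrε
  refine ⟨r.toReal, ENNReal.toReal_pos hr.ne' hr', fun κ' hκ' => ?_⟩
  refine h _ ((ghpDist_ofCurve_le hζ κ κ' fun s => ?_).trans_lt hrε)
  rw [Metric.mem_ball, dist_comm] at hκ'
  rw [edist_dist]
  exact ENNReal.ofReal_le_of_le_toReal
    ((ContinuousMap.dist_apply_le_dist s).trans hκ'.le)

end ContPseudoMetric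

/-! ### Range and coded tree, as spaces induced by curves -/

/-- The rescaled tree distance along the interpolation of `y`. -/
def pathPseudoMetric {t : OrderedTree} (y : ℕ → Vertex t) (ζ : ℝ) (n : ℕ) (a : ℝ) (ha : 0 < a) :
    ContPseudoMetric ζ where
  d s s' := (1 / a) * dist (interp y (n * s)) (interp y (n * s'))
  self s := by rw [dist_self, mul_zero]
  symm s s' := by rw [dist_comm]
  triangle s s' s'' := by
    rw [← mul_add]
    exact mul_le_mul_of_nonneg_left (dist_triangle _ _ _) (one_div_pos.2 ha).le
  continuous := by
    have h := continuous_interp_comp y ζ n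
    exact continuous_const.mul ((h.comp continuous_fst).dist (h.comp continuous_snd))

theorem rangeSpace_toGHP {t : OrderedTree} (y : ℕ → Vertex t) (ζ : ℝ) (hζ : 0 < ζ) (n : ℕ)
    (a : ℝ) (ha : 0 < a) :
    (rangeSpace y ζ hζ n a ha).toGHP =
      ((ContPseudoMetric.ofCurve (pathPseudoMetric y ζ n a ha).curve).space hζ).toGHP := by
  rw [ContPseudoMetric.ofCurve_curve_toGHP]
  symm
  refine ContPseudoMetric.space_toGHP_eq _ hζ (rangeSpace y ζ hζ n a ha)
    (fun s => toScaled (one_div_pos.2 ha) (toPathRange y ζ n s)) (fun s s' => rfl) ?_ rfl rfl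
  rintro ⟨_, r, hr, rfl⟩
  -- For `n = 0` the range is a single point, and the time change `r / n` is not available.
  rcases eq_or_ne n 0 with rfl | hn
  · refine ⟨⟨0, le_rfl, hζ.le⟩, Subtype.ext ?_⟩
    have : r = 0 := le_antisymm (by simpa using hr.2) hr.1
    simp [toScaled, toPathRange, this]
  · have hn0 : (0 : ℝ) < n := by exact_mod_cast Nat.pos_of_ne_zero hn
    refine ⟨⟨r / n, div_nonneg hr.1 hn0.le, (div_le_iff₀ hn0).2 hr.2⟩, Subtype.ext ?_⟩
    simp only [toScaled, toPathRange]
    rw [mul_div_cancel₀ _ hn0.ne']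

theorem codedTree_toGHP {ζ : ℝ} (hζ : 0 < ζ) (h : C(Icc (0 : ℝ) ζ, ℝ)) :
    (codedTree hζ h).toGHP =
      ((ContPseudoMetric.ofCurve (codedPseudoMetric h).curve).space hζ).toGHP :=
  ((codedPseudoMetric h).ofCurve_curve_toGHP hζ).symm

/-! ### Continuity of the coded pseudo-metric in the height function -/

theorem dist_minBetween_le {ζ : ℝ} (h h' : C(Icc (0 : ℝ) ζ, ℝ)) (s s' : Icc (0 : ℝ) ζ) :
    dist (minBetween h s s') (minBetween h' s s') ≤ dist h h' := by
  have key : ∀ h h' : C(Icc (0 : ℝ) ζ, ℝ),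
      minBetween h s s' - dist h h' ≤ minBetween h' s s' := by
    intro h h'
    refine le_minBetween h' fun u hu => ?_
    have h1 := minBetween_le h hu
    have h2 := ContinuousMap.dist_apply_le_dist (f := h) (g := h') u
    rw [Real.dist_eq, abs_le] at h2
    linarith
  have h1 := key h h'
  have h2 := key h' h
  rw [dist_comm h' h] at h2
  rw [Real.dist_eq, abs_le]
  constructor <;> linarith

theorem continuous_codedPseudoMetric_curve (ζ : ℝ) :
    Continuous fun h : C(Icc (0 : ℝ) ζ, ℝ) => (codedPseudoMetric h).curve := by
  -- The constant `4` counts two values of `h` and twice a minimum, each 1-Lipschitz in `h`.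
  refine (LipschitzWith.of_dist_le_mul (K := 4)
    (f := fun h : C(Icc (0 : ℝ) ζ, ℝ) => (codedPseudoMetric h).curve) fun h h' => ?_).continuous
  have h0 : (0 : ℝ) ≤ (4 : NNReal) * dist h h' := by positivity
  refine (ContinuousMap.dist_le h0).2 fun s => (ContinuousMap.dist_le h0).2 fun s' => ?_
  have e : ∀ h : C(Icc (0 : ℝ) ζ, ℝ), (codedPseudoMetric h).curve s s' = h s + h s' - 2 * minBetween h s s' :=
    fun _ => rfl
  have h1 := ContinuousMap.dist_apply_le_dist (f := h) (g := h') s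
  have h2 := ContinuousMap.dist_apply_le_dist (f := h) (g := h') s'
  have h3 := dist_minBetween_le h h' s s'
  rw [Real.dist_eq, abs_le] at h1 h2 h3
  rw [e, e, Real.dist_eq, abs_le]
  push_cast
  constructor <;> linarith

/-! ### Comparison in probability and conclusion -/

section Convergence

variable {t : OrderedTree} {Ω : Type*} [MeasurableSpace Ω] {P : Measure Ω}
  {lam : ℝ} {Y : ℕ → Ω → Vertex t}

theorem tendsto_atTop_of_log_div_tendsto_zero {a : ℕ → ℝ} (ha : ∀ n, 0 < a n)
    (hlog : Tendsto (fun n : ℕ => Real.log n / a n) atTop (𝓝 0)) : Tendsto a atTop atTop := by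
  refine tendsto_atTop_mono' atTop ?_
    (Real.tendsto_log_atTop.comp (tendsto_natCast_atTop_atTop (R := ℝ)))
  filter_upwards [hlog.eventually_lt_const one_pos] with n hn
  rw [div_lt_one (ha n)] at hn
  exact hn.le

/-- With high probability, the walk does not backtrack by more than `δ a n` up to a time of
order `n`, if `log n = o(a n)`. -/
theorem IsBiasedWalk.tendsto_measure_backtracks [IsProbabilityMeasure P]
    (hY : IsBiasedWalk P t lam Y) (hlam : 1 < lam) {ζ : ℝ} (hζ : 0 < ζ) {a : ℕ → ℝ}
    (ha : ∀ n, 0 < a n) (hlog : Tendsto (fun n : ℕ => Real.log n / a n) atTop (𝓝 0))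
    {δ : ℝ} (hδ : 0 < δ) :
    Tendsto (fun n : ℕ => P {ω | Backtracks (fun m => Y m ω) ⌊δ * a n⌋₊ ⌈n * ζ⌉₊})
      atTop (𝓝 0) := by
  have hl0 : 0 < lam := by linarith
  have hll : 0 < Real.log lam := Real.log_pos hlam
  set c := δ * Real.log lam with hc
  have hc0 : 0 < c := by positivity
  have hlim : Tendsto (fun n : ℕ => ENNReal.ofReal (lam ^ 2 * (ζ + 2) ^ 4 * (1 / (n : ℝ))))
      atTop (𝓝 0) := by
    rw [← ENNReal.ofReal_zero]
    refine ENNReal.tendsto_ofReal ?_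
    simpa using (tendsto_one_div_atTop_nhds_zero_nat (𝕜 := ℝ)).const_mul
      (lam ^ 2 * (ζ + 2) ^ 4)
  refine tendsto_of_tendsto_of_tendsto_of_le_of_le' tendsto_const_nhds hlim
    (Eventually.of_forall fun _ => zero_le) ?_
  -- With `log n < (c / 5) * a n` one gets `n ^ 5 ≤ lam ^ (k + 1)`. The bound on backtracking grows
  -- like `n ^ 4`: three powers from the union bound, one from the drift at the root. A factor `1 /
  -- n` is left.
  filter_upwards [hlog.eventually_lt_const (by positivity : 0 < c / 5), eventually_ge_atTop 1]
    with n hn hn1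
  have hn1' : (1 : ℝ) ≤ n := by exact_mod_cast hn1
  have hn0 : (0 : ℝ) < n := by linarith
  set k := ⌊δ * a n⌋₊ with hk
  set N := ⌈(n : ℝ) * ζ⌉₊ with hN
  have hNn : (N : ℝ) + 1 ≤ n * (ζ + 2) := by
    have := Nat.ceil_lt_add_one (mul_nonneg hn0.le hζ.le)
    rw [← hN] at this
    linarith
  have hk1 : δ * a n < k + 1 := Nat.lt_floor_add_one _
  have hpow : (lam ^ k)⁻¹ ≤ lam * ((n : ℝ) ^ 5)⁻¹ := by
    have h1 : (n : ℝ) ^ 5 ≤ lam ^ (k + 1) := by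
      rw [← Real.log_le_log_iff (by positivity) (by positivity), Real.log_pow, Real.log_pow]
      rw [div_lt_iff₀ (ha n)] at hn
      have : δ * a n * Real.log lam ≤ (k + 1) * Real.log lam :=
        mul_le_mul_of_nonneg_right hk1.le hll.le
      push_cast
      rw [hc] at hn
      linarith
    rw [← div_eq_mul_inv, le_div_iff₀ (by positivity), inv_mul_le_iff₀ (by positivity)]
    rwa [pow_succ] at h1
  refine (hY.measure_backtracks_le hlam.le k N).trans ?_
  have e : ((N : ℝ≥0∞) + 1) ^ 3 *
      (ENNReal.ofReal (lam ^ k)⁻¹ * (1 + N * ENNReal.ofReal (lam - 1))) =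
      ENNReal.ofReal (((N : ℝ) + 1) ^ 3 * ((lam ^ k)⁻¹ * (1 + N * (lam - 1)))) := by
    have h1 : 0 ≤ lam - 1 := by linarith
    rw [ENNReal.ofReal_mul (by positivity), ENNReal.ofReal_mul (by positivity),
      ENNReal.ofReal_add zero_le_one (by positivity), ENNReal.ofReal_mul (by positivity),
      ENNReal.ofReal_pow (by positivity), ENNReal.ofReal_add (by positivity) zero_le_one,
      ENNReal.ofReal_one, ENNReal.ofReal_natCast]
  rw [e]
  refine ENNReal.ofReal_le_ofReal ?_
  have h1 : 1 + N * (lam - 1) ≤ lam * ((N : ℝ) + 1) := by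
    have : (0 : ℝ) ≤ N := Nat.cast_nonneg N
    nlinarith
  calc ((N : ℝ) + 1) ^ 3 * ((lam ^ k)⁻¹ * (1 + N * (lam - 1)))
      ≤ ((N : ℝ) + 1) ^ 3 * ((lam * ((n : ℝ) ^ 5)⁻¹) * (lam * ((N : ℝ) + 1))) := by
        gcongr
    _ = lam ^ 2 * ((n : ℝ) ^ 5)⁻¹ * ((N : ℝ) + 1) ^ 4 := by ring
    _ ≤ lam ^ 2 * ((n : ℝ) ^ 5)⁻¹ * (n * (ζ + 2)) ^ 4 := by gcongr
    _ = lam ^ 2 * (ζ + 2) ^ 4 * (1 / (n : ℝ)) := by field_simp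

theorem IsPath.dist_curve_le {y : ℕ → Vertex t} (hy : IsPath y) {k N : ℕ}
    (hb : ¬ Backtracks y k N) {ζ : ℝ} {n : ℕ} (hN : n * ζ ≤ N) {a : ℝ} (ha : 0 < a) :
    dist (pathPseudoMetric y ζ n a ha).curve (codedPseudoMetric (rescaledHeight y ζ n a)).curve ≤
      (1 / a) * (2 * k + 6) := by
  have h0 : 0 ≤ (1 / a) * (2 * (k : ℝ) + 6) := by positivity
  refine (ContinuousMap.dist_le h0).2 fun s => (ContinuousMap.dist_le h0).2 fun s' => ?_
  exact hy.abs_dist_sub_coded_le hb hN ha s s'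

/-! ### Measurability and Slutsky's theorem -/

/-- A functional of finitely many steps of the walk is measurable. -/
theorem IsBiasedWalk.measurable_of_eq (hY : IsBiasedWalk P t lam Y) {α : Type*}
    [MeasurableSpace α] (N : ℕ) (Φ : (ℕ → Vertex t) → α)
    (hΦ : ∀ y y' : ℕ → Vertex t, (∀ n ≤ N, y n = y' n) → Φ y = Φ y') :
    Measurable fun ω => Φ fun n => Y n ω := by
  let _ : MeasurableSpace (Fin (N + 1) → Vertex t) := ⊤
  have e : (fun ω => Φ fun n => Y n ω) = (fun p : Fin (N + 1) → Vertex t =>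
      Φ fun n => p ⟨min n N, by omega⟩) ∘ history Y N := by
    funext ω
    refine hΦ _ _ fun n hn => ?_
    simp [history, min_eq_left hn]
  rw [e]
  exact (measurable_of_countable _).comp
    (measurable_of_countable_fibers (hY.measurableSet_history N))

theorem interp_congr {y y' : ℕ → Vertex t} {N : ℕ} (h : ∀ n ≤ N + 1, y n = y' n) {r : ℝ}
    (hr : r ≤ N) : interp y r = interp y' r := by
  have hf : ⌊r⌋₊ ≤ N := Nat.floor_le_of_le hr
  rw [interp, interp, h _ (by omega), h _ (by omega)]

/-- Interpolation at time `r` reads the path at `⌊r⌋₊` and `⌊r⌋₊ + 1`, hence the extra index. This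
gives measurability of the pair. -/
theorem heightAndCurve_congr {y y' : ℕ → Vertex t} {ζ : ℝ} {n : ℕ}
    (h : ∀ m ≤ ⌈(n : ℝ) * ζ⌉₊ + 1, y m = y' m) (a : ℝ) (ha : 0 < a) :
    (rescaledHeight y ζ n a, (pathPseudoMetric y ζ n a ha).curve) =
      (rescaledHeight y' ζ n a, (pathPseudoMetric y' ζ n a ha).curve) := by
  have hi : ∀ s : Icc (0 : ℝ) ζ, interp y (n * s) = interp y' (n * s) := fun s =>
    interp_congr h ((mul_le_mul_of_nonneg_left s.2.2 (Nat.cast_nonneg n)).trans (Nat.le_ceil _))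
  refine Prod.ext (ContinuousMap.ext fun s => ?_)
    (ContinuousMap.ext fun s => ContinuousMap.ext fun s' => ?_)
  · rw [rescaledHeight_apply, rescaledHeight_apply, hi]
  · simp only [ContPseudoMetric.curve_apply, pathPseudoMetric]
    rw [hi, hi]

/-- Slutsky's theorem for the second component of a pair. -/
theorem tendstoInDistribution_prodMk_of_tendsto_measure_dist [IsProbabilityMeasure P]
    {E F Ω' : Type*} [SeminormedAddCommGroup E] [SeminormedAddCommGroup F] [MeasurableSpace E]
    [MeasurableSpace F] [BorelSpace E] [BorelSpace F] [SecondCountableTopology E]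
    [SecondCountableTopology F] [MeasurableSpace Ω'] {P' : Measure Ω'} [IsProbabilityMeasure P']
    {X : ℕ → Ω → E} {U V : ℕ → Ω → F} {Z : Ω' → E × F}
    (hU : TendstoInDistribution (fun n ω => (X n ω, U n ω)) atTop Z (fun _ => P) P')
    (hUV : ∀ ε, 0 < ε → Tendsto (fun n => P {ω | ε ≤ dist (V n ω) (U n ω)}) atTop (𝓝 0))
    (hV : ∀ n, AEMeasurable (fun ω => (X n ω, V n ω)) P) :
    TendstoInDistribution (fun n ω => (X n ω, V n ω)) atTop Z (fun _ => P) P' := by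
  refine tendstoInDistribution_of_tendstoInMeasure_sub _ _ hU
    (tendstoInMeasure_iff_norm.2 fun ε hε => ?_) hV
  refine (hUV ε hε).congr fun n => ?_
  congr 1
  ext ω
  simp [Prod.norm_def, dist_eq_norm]

theorem IsBiasedWalk.tendsto_measure_dist_curve [IsProbabilityMeasure P]
    (hY : IsBiasedWalk P t lam Y) (hlam : 1 < lam) {ζ : ℝ} (hζ : 0 < ζ) {a : ℕ → ℝ}
    (ha : ∀ n, 0 < a n) (hlog : Tendsto (fun n : ℕ => Real.log n / a n) atTop (𝓝 0))
    {ε : ℝ} (hε : 0 < ε) :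
    Tendsto (fun n : ℕ => P {ω | ε ≤
      dist (pathPseudoMetric (fun m => Y m ω) ζ n (a n) (ha n)).curve
        (codedPseudoMetric (rescaledHeight (fun m => Y m ω) ζ n (a n))).curve}) atTop (𝓝 0) := by
  -- With `k = ⌊ε / 4 * a n⌋₊` the term `2 * k / a n` is at most `ε / 2`, and `a n > 12 / ε` makes
  -- `6 / a n` less than `ε / 2`.
  refine tendsto_of_tendsto_of_tendsto_of_le_of_le' tendsto_const_nhds
    (hY.tendsto_measure_backtracks hlam hζ ha hlog (by positivity : 0 < ε / 4))
    (Eventually.of_forall fun _ => zero_le) ?_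
  filter_upwards [(tendsto_atTop_of_log_div_tendsto_zero ha hlog).eventually_gt_atTop (12 / ε)]
    with n hn
  refine measure_mono_ae ?_
  filter_upwards [hY.ae_adjacent] with ω hω hd
  by_contra hb
  have h1 := IsPath.dist_curve_le (y := fun m => Y m ω) hω hb (Nat.le_ceil _) (ha n)
  have h2 : (⌊ε / 4 * a n⌋₊ : ℝ) ≤ ε / 4 * a n :=
    Nat.floor_le (mul_nonneg (by positivity) (ha n).le)
  rw [div_lt_iff₀ hε] at hn
  have h3 : 1 / a n * (2 * ⌊ε / 4 * a n⌋₊ + 6) < ε := by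
    rw [one_div, inv_mul_lt_iff₀ (ha n)]
    linarith
  exact (hd.trans h1).not_gt h3

end Convergence

end TreeWalk

end

theorem mainTheorem8 {Ω Ω' : Type*} [MeasurableSpace Ω] [MeasurableSpace Ω']
    (P : MeasureTheory.Measure Ω) [MeasureTheory.IsProbabilityMeasure P]
    (P' : MeasureTheory.Measure Ω') [MeasureTheory.IsProbabilityMeasure P']
    (t : TreeWalk.OrderedTree) (ht : t.carrier.Infinite)
    (lam : ℝ) (hlam : 1 < lam)
    (Y : ℕ → Ω → TreeWalk.Vertex t) (hY : TreeWalk.IsBiasedWalk P t lam Y)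
    (hrec : TreeWalk.IsRecurrent P Y)
    (ζ : ℝ) (hζ : 0 < ζ)
    (a : ℕ → ℝ) (ha : ∀ n, 0 < a n)
    (hlog : Filter.Tendsto (fun n : ℕ => Real.log n / a n) Filter.atTop (nhds 0))
    (H : Ω' → C(Set.Icc (0 : ℝ) ζ, ℝ))
    (hH : TreeWalk.TendstoInLaw
      (fun n ω => TreeWalk.rescaledHeight (fun k => Y k ω) ζ n (a n)) H P P') :
    TreeWalk.TendstoInLaw
      (fun n ω => (TreeWalk.rescaledHeight (fun k => Y k ω) ζ n (a n),
        (TreeWalk.rangeSpace (fun k => Y k ω) ζ hζ n (a n) (ha n)).toGHP))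
      (fun ω => (H ω, (TreeWalk.codedTree hζ (H ω)).toGHP)) P P' := by
  let _ : MeasurableSpace C(Icc (0 : ℝ) ζ, ℝ) := borel _
  have _ : BorelSpace C(Icc (0 : ℝ) ζ, ℝ) := ⟨rfl⟩
  let _ : MeasurableSpace C(Icc (0 : ℝ) ζ, C(Icc (0 : ℝ) ζ, ℝ)) := borel _
  have _ : BorelSpace C(Icc (0 : ℝ) ζ, C(Icc (0 : ℝ) ζ, ℝ)) := ⟨rfl⟩
  let _ : MeasurableSpace (C(Icc (0 : ℝ) ζ, ℝ) × TreeWalk.GHPSpace) := borel _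
  have _ : BorelSpace (C(Icc (0 : ℝ) ζ, ℝ) × TreeWalk.GHPSpace) := ⟨rfl⟩
  have hH' : TendstoInDistribution
      (fun n ω => TreeWalk.rescaledHeight (fun k => Y k ω) ζ n (a n)) atTop H
      (fun _ => P) P' := hH
  -- The height with its own coded curve is a continuous image of the height. `h2` replaces the
  -- coded curve by the curve of the path, and `h3` passes from curves to GHP classes.
  have h1 := hH'.continuous_comp
    (continuous_id.prodMk (TreeWalk.continuous_codedPseudoMetric_curve ζ))
  have h2 := TreeWalk.tendstoInDistribution_prodMk_of_tendsto_measure_dist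
    (V := fun n ω => (TreeWalk.pathPseudoMetric (fun m => Y m ω) ζ n (a n) (ha n)).curve) h1
    (fun ε hε => hY.tendsto_measure_dist_curve hlam hζ ha hlog hε)
    fun n => (hY.measurable_of_eq (⌈(n : ℝ) * ζ⌉₊ + 1) (fun y =>
      (TreeWalk.rescaledHeight y ζ n (a n),
        (TreeWalk.pathPseudoMetric y ζ n (a n) (ha n)).curve))
      fun y y' h => TreeWalk.heightAndCurve_congr h (a n) (ha n)).aemeasurable
  have h3 := h2.continuous_comp (continuous_fst.prodMk
    ((TreeWalk.ContPseudoMetric.continuous_ofCurve_toGHP hζ).comp continuous_snd))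
  simp only [TreeWalk.rangeSpace_toGHP, TreeWalk.codedTree_toGHP]
  exact h3
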